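/- Let $a>0$, $b\ge 0$, $D>0$, $E\ge 0$ and let $T_e<T_c$, $T_\delta=T_c-T_e$. For an initial temperature $T_0$, a power policy $P:[0,D]\to[0,\infty)$ (measurable) generates the temperature $$T(t)=e^{-bt}\left(\int_0^t e^{b\tau}\bigl(aP(\tau)+bT_e\bigr)\,d\tau+T_0\right),$$ that is, the solution of $T'=aP-b(T-T_e)$, $T(0)=T_0$. The policy $P$ is feasible if it is integrable, $\int_0^tP(\tau)\,d\tau\le E$ and $T(t)\le T_c$ for all $t\in[0,D]$ (the energy $E$ is available at time $0$ and there is no later arrival), and it is optimal if it maximizes the throughput $\int_0^D\frac12\log_2(1+P(\tau))\,d\tau$ among the feasible policies. Policies that are equal almost everywhere on $[0,D]$ generate the same temperature and throughput, and are identified. (1) Assume $T_e<T_0<T_c$ and let $P$ be an optimal policy. Then, after a change on a null set that preserves optimality, $P$ is monotone decreasing (non-increasing) on $[0,D]$, and the following holds: if the temperature $T$ takes the value $T_c$ on $[0,D]$ and $t_h=\min\{t\in[0,D]:T(t)=T_c\}$ satisfies $t_h<D$, then $P(t)=\frac{T_\delta b}{a}$ for all $t\in[t_h,D]$, and $T$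 is monotone increasing (non-decreasing) and concave on $[0,D]$. (2) Assume $T_0=T_c$. Then the constant policy $\min\left\{\frac{T_\delta b}{a},\frac ED\right\}$ is optimal, and every optimal policy satisfies $P(t)=\min\left\{\frac{T_\delta b}{a},\frac ED\right\}$ for almost every $t\in[0,D]$. -/

import Mathlib

open MeasureTheory Set

/-- Temperature at time `t` produced by the power policy `P`, with heating coefficient `a`, cooling
coefficient `b`, environment temperature `Te` and initial temperature `T0`: the solution
`e^{-bt} (∫₀ᵗ e^{bτ} (a P(τ) + b Te) dτ + T0)` of `T' = a P - b (T - Te)`, `T(0) = T0`. -/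
noncomputable def temperature (a b Te T0 : ℝ) (P : ℝ → ℝ) (t : ℝ) : ℝ :=
  Real.exp (-(b * t)) * ((∫ τ in (0 : ℝ)..t, Real.exp (b * τ) * (a * P τ + b * Te)) + T0)

theorem temperature_zero (a b Te T0 : ℝ) (P : ℝ → ℝ) : temperature a b Te T0 P 0 = T0 := by
  simp [temperature]

/-- The temperature satisfies the thermal dynamics `T' = a P - b (T - Te)` almost everywhere. -/
theorem temperature_ode (a b Te T0 D : ℝ) (P : ℝ → ℝ) (hD : 0 < D)
    (hP : IntegrableOn P (Icc 0 D)) :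
    ∀ᵐ t, t ∈ Ioo 0 D → HasDerivAt (temperature a b Te T0 P)
      (a * P t - b * (temperature a b Te T0 P t - Te)) t := by
  have hPi : IntervalIntegrable P volume 0 D :=
    (intervalIntegrable_iff_integrableOn_Icc_of_le hD.le).2 hP
  have hg : IntervalIntegrable (fun τ => Real.exp (b * τ) * (a * P τ + b * Te)) volume 0 D :=
    ((hPi.const_mul a).add intervalIntegrable_const).continuousOn_mul
      (by fun_prop)
  filter_upwards [hg.ae_hasDerivAt_integral] with t ht htD
  have h1 := ht (by rw [uIcc_of_le hD.le]; exact ⟨htD.1.le, htD.2.le⟩) 0 (by simp)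
  have h2 : HasDerivAt (fun t : ℝ => Real.exp (-(b * t))) (Real.exp (-(b * t)) * -(b * 1)) t :=
    (((hasDerivAt_id t).const_mul b).neg).exp
  have h3 := h2.mul (h1.add_const T0)
  refine h3.congr_deriv ?_
  have h4 : Real.exp (-(b * t)) * Real.exp (b * t) = 1 := by
    rw [← Real.exp_add]; simp
  simp only [temperature]
  linear_combination (a * P t + b * Te) * h4

/-- Feasible power policies on `[0, D]` when the energy `E` is available at time zero and there is
no further arrival: nonnegative (Lebesgue) measurable functions on `[0, D]` with finite integral
that never spend more than `E` and never heat above `Tc`. -/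
structure IsFeasiblePolicy (a b Te Tc T0 E D : ℝ) (P : ℝ → ℝ) : Prop where
  nonneg : ∀ t ∈ Icc 0 D, 0 ≤ P t
  integrableOn : IntegrableOn P (Icc 0 D)
  energy_le : ∀ t ∈ Icc 0 D, ∫ τ in (0 : ℝ)..t, P τ ≤ E
  temperature_le : ∀ t ∈ Icc 0 D, temperature a b Te T0 P t ≤ Tc

/-- Number of bits sent by the deadline `D`. -/
noncomputable def throughput (D : ℝ) (P : ℝ → ℝ) : ℝ :=
  ∫ τ in (0 : ℝ)..D, 1 / 2 * Real.logb 2 (1 + P τ)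

/-- A feasible policy of maximal throughput among all feasible policies. -/
structure IsOptimalPolicy (a b Te Tc T0 E D : ℝ) (P : ℝ → ℝ) : Prop where
  feasible : IsFeasiblePolicy a b Te Tc T0 E D P
  throughput_le : ∀ Q : ℝ → ℝ, IsFeasiblePolicy a b Te Tc T0 E D Q →
    throughput D Q ≤ throughput D P

/-!
# Throughput-optimal power policies under a temperature constraint

Optimal policies are compared with explicit feasible competitors: since the throughput is strictly
concave, a competitor which is at least as good agrees with the optimal policy almost everywhere.
-/

/-! The temperature is affine in the power, so the feasible set is convex, and the throughput is
strictly concave. Hence a feasible competitor at least as good as an optimal policy coincides with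
it almost everywhere (`IsOptimalPolicy.ae_eq`), and each property of the optimum comes from one
competitor.

Let c = (Tc - Te) b / a, the power that holds the temperature at Tc. From a time at which T = Tc,
integrating T' = aP - b(T - Te) shows that the average of the remaining power is at most c. Whenever
that average is at most c, replacing the remaining power by it is feasible and, by Jensen, no worse
(`IsOptimalPolicy.ae_eq_average`). At T0 = Tc this reasoning, with the energy bound, gives the
constant optimum. At the first hitting time the average must equal c: otherwise the policy would
already be a constant below c slightly earlier, too weak to heat up to Tc
(`IsOptimalPolicy.ae_eq_after_critical`).

While T < Tc, moving a little power from a later window to an earlier one evens out the powers, and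
the heat it brings has longer to decay; so P cannot increase there (`IsOptimalPolicy.ae_shift_le`).
Differentiating the cumulative energy turns this into a monotone representative. A bound on the
initial energy rate (`IsOptimalPolicy.exists_integral_le`) keeps it finite at time 0. Finally P ≥ c
makes T nondecreasing, and then aP - b(T - Te) is nonincreasing, so T is concave. -/

/-! ### Temperature as an affine functional of the power. -/

theorem IsFeasiblePolicy.intervalIntegrable {a b Te Tc T0 E D : ℝ} {P : ℝ → ℝ}
    (hP : IsFeasiblePolicy a b Te Tc T0 E D P) (hD : 0 < D) {s t : ℝ} (hs : s ∈ Icc 0 D)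
    (ht : t ∈ Icc 0 D) : IntervalIntegrable P volume s t :=
  ((intervalIntegrable_iff_integrableOn_Icc_of_le hD.le).2 hP.integrableOn).mono_set
    (by rw [uIcc_of_le hD.le]; exact uIcc_subset_Icc hs ht)

theorem exp_mul_intervalIntegrable (a b Te : ℝ) {P : ℝ → ℝ} {s t : ℝ}
    (hP : IntervalIntegrable P volume s t) :
    IntervalIntegrable (fun τ => Real.exp (b * τ) * (a * P τ + b * Te)) volume s t :=
  ((hP.const_mul a).add intervalIntegrable_const).continuousOn_mul (by fun_prop)

/-- For `c = Tc` the integrand is that of the power holding the temperature at `Tc`, the reference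
in the comparisons below. -/
theorem integral_exp_mul_const (b c s t : ℝ) :
    ∫ τ in s..t, Real.exp (b * τ) * (b * c) = (Real.exp (b * t) - Real.exp (b * s)) * c := by
  have h : ∀ x ∈ uIcc s t,
      HasDerivAt (fun τ => Real.exp (b * τ) * c) (Real.exp (b * x) * (b * c)) x := by
    intro x _
    have := (((hasDerivAt_id x).const_mul b).exp).mul_const c
    refine this.congr_deriv ?_
    simp; ring
  rw [intervalIntegral.integral_eq_sub_of_hasDerivAt h
    (Continuous.intervalIntegrable (by fun_prop) _ _)]
  ring

theorem exp_mul_temperature (a b Te T0 : ℝ) (P : ℝ → ℝ) (t : ℝ) :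
    Real.exp (b * t) * temperature a b Te T0 P t =
      (∫ τ in (0 : ℝ)..t, Real.exp (b * τ) * (a * P τ + b * Te)) + T0 := by
  rw [temperature, ← mul_assoc, ← Real.exp_add]; simp

/-- The temperature at time `t` in terms of the temperature at an earlier time `s`. -/
theorem exp_mul_temperature_sub (a b Te T0 D : ℝ) {P : ℝ → ℝ}
    (hP : IntervalIntegrable P volume 0 D) {s t : ℝ} (hs : s ∈ Icc 0 D) (ht : t ∈ Icc 0 D) :
    Real.exp (b * t) * temperature a b Te T0 P t - Real.exp (b * s) * temperature a b Te T0 P s =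
      ∫ τ in s..t, Real.exp (b * τ) * (a * P τ + b * Te) := by
  have hD : 0 ≤ D := hs.1.trans hs.2
  have h : ∀ u ∈ Icc 0 D, IntervalIntegrable P volume 0 u := fun u hu =>
    hP.mono_set (by rw [uIcc_of_le hD]; exact uIcc_subset_Icc ⟨le_rfl, hD⟩ hu)
  rw [exp_mul_temperature, exp_mul_temperature, add_sub_add_right_eq_sub,
    intervalIntegral.integral_interval_sub_left
      (exp_mul_intervalIntegrable a b Te (h t ht)) (exp_mul_intervalIntegrable a b Te (h s hs))]

/-- Reduces the feasibility of a perturbed policy to estimates of the weighted integral of the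
perturbation. -/
theorem temperature_sub (a b Te T0 : ℝ) {P Q : ℝ → ℝ} {t : ℝ}
    (hP : IntervalIntegrable P volume 0 t) (hQ : IntervalIntegrable Q volume 0 t) :
    temperature a b Te T0 Q t - temperature a b Te T0 P t =
      a * (Real.exp (-(b * t)) * ∫ τ in (0 : ℝ)..t, Real.exp (b * τ) * (Q τ - P τ)) := by
  have h : (∫ τ in (0 : ℝ)..t, Real.exp (b * τ) * (a * Q τ + b * Te)) -
      (∫ τ in (0 : ℝ)..t, Real.exp (b * τ) * (a * P τ + b * Te)) =
      a * ∫ τ in (0 : ℝ)..t, Real.exp (b * τ) * (Q τ - P τ) := by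
    rw [← intervalIntegral.integral_sub (exp_mul_intervalIntegrable a b Te hQ)
      (exp_mul_intervalIntegrable a b Te hP), ← intervalIntegral.integral_const_mul]
    congr 1; ext τ; ring
  simp only [temperature]
  linear_combination Real.exp (-(b * t)) * h

theorem temperature_le_of_integral_nonpos {a b Te T0 : ℝ} (ha : 0 < a) {P Q : ℝ → ℝ} {t : ℝ}
    (hP : IntervalIntegrable P volume 0 t) (hQ : IntervalIntegrable Q volume 0 t)
    (h : ∫ τ in (0 : ℝ)..t, Real.exp (b * τ) * (Q τ - P τ) ≤ 0) :
    temperature a b Te T0 Q t ≤ temperature a b Te T0 P t := by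
  have h1 := temperature_sub a b Te T0 hP hQ
  have h2 := mul_nonpos_of_nonneg_of_nonpos ha.le
    (mul_nonpos_of_nonneg_of_nonpos (Real.exp_pos (-(b * t))).le h)
  linarith

theorem temperature_congr (a b Te T0 : ℝ) {P Q : ℝ → ℝ} {t : ℝ} (ht : 0 ≤ t)
    (h : ∀ᵐ τ, τ ∈ Ioc 0 t → Q τ = P τ) :
    temperature a b Te T0 Q t = temperature a b Te T0 P t := by
  simp only [temperature]
  congr 2
  refine intervalIntegral.integral_congr_ae ?_
  rw [uIoc_of_le ht]
  filter_upwards [h] with τ hτ hm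
  rw [hτ hm]

/-- Absolute continuity allows the differential equation, valid only almost everywhere, to be
integrated. -/
theorem temperature_absolutelyContinuous (a b Te T0 D : ℝ) {P : ℝ → ℝ}
    (hP : IntervalIntegrable P volume 0 D) :
    AbsolutelyContinuousOnInterval (temperature a b Te T0 P) 0 D := by
  have h1 := (exp_mul_intervalIntegrable a b Te hP).absolutelyContinuousOnInterval_intervalIntegral
    (c := 0) (by simp)
  have h2 : ContDiff ℝ 1 (fun t : ℝ => Real.exp (-(b * t))) := by fun_prop
  have h4 : ∀ c : ℝ, AbsolutelyContinuousOnInterval (fun _ : ℝ => c) 0 D := fun c =>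
    ((LipschitzWith.const c).lipschitzOnWith (s := uIcc 0 D)).absolutelyContinuousOnInterval
  have h3 : AbsolutelyContinuousOnInterval (fun t : ℝ => Real.exp (-(b * t))) 0 D := by
    obtain ⟨K, hK⟩ := h2.contDiffOn.exists_lipschitzOnWith one_ne_zero (convex_uIcc 0 D)
      isCompact_uIcc
    exact hK.absolutelyContinuousOnInterval
  exact h3.fun_mul (h1.fun_add (h4 T0))

theorem temperature_continuousOn (a b Te T0 D : ℝ) (hD : 0 ≤ D) {P : ℝ → ℝ}
    (hP : IntervalIntegrable P volume 0 D) :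
    ContinuousOn (temperature a b Te T0 P) (Icc 0 D) := by
  simpa [uIcc_of_le hD] using (temperature_absolutelyContinuous a b Te T0 D hP).continuousOn

/-- The thermal dynamics in integrated form. -/
theorem temperature_sub_eq_integral (a b Te T0 D : ℝ) (hD : 0 < D) {P : ℝ → ℝ}
    (hP : IntervalIntegrable P volume 0 D) {s t : ℝ} (hs : s ∈ Icc 0 D) (ht : t ∈ Icc 0 D) :
    temperature a b Te T0 P t - temperature a b Te T0 P s =
      ∫ τ in s..t, (a * P τ - b * (temperature a b Te T0 P τ - Te)) := by
  have hsub : uIcc s t ⊆ uIcc 0 D := by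
    rw [uIcc_of_le hD.le]; exact uIcc_subset_Icc hs ht
  rw [← ((temperature_absolutelyContinuous a b Te T0 D hP).mono hsub).integral_deriv_eq_sub]
  refine intervalIntegral.integral_congr_ae ?_
  have h0 : ∀ᵐ x : ℝ, x ≠ 0 := by simp [ae_iff]
  have h1 : ∀ᵐ x : ℝ, x ≠ D := by simp [ae_iff]
  filter_upwards [temperature_ode a b Te T0 D P hD
    ((intervalIntegrable_iff_integrableOn_Icc_of_le hD.le).1 hP), h0, h1] with x hx hx0 hxD hm
  have hm' := hsub (uIoc_subset_uIcc hm)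
  rw [uIcc_of_le hD.le] at hm'
  exact (hx ⟨lt_of_le_of_ne hm'.1 hx0.symm, lt_of_le_of_ne hm'.2 hxD⟩).deriv

/-! ### Comparison with the power that holds the critical temperature. -/

/-- A power at most `(Tc - Te) * b / a` never heats above `Tc`. -/
theorem temperature_le_of_le {a b Te Tc T0 D : ℝ} (ha : 0 < a) {P : ℝ → ℝ}
    (hP : IntervalIntegrable P volume 0 D) {s t : ℝ} (hs : s ∈ Icc 0 D) (ht : t ∈ Icc 0 D)
    (hst : s ≤ t) (hle : ∀ᵐ τ, τ ∈ Ioc s t → P τ ≤ (Tc - Te) * b / a) :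
    Real.exp (b * t) * (temperature a b Te T0 P t - Tc) ≤
      Real.exp (b * s) * (temperature a b Te T0 P s - Tc) := by
  have h1 := exp_mul_temperature_sub a b Te T0 D hP hs ht
  have h2 := integral_exp_mul_const b Tc s t
  have hi : IntervalIntegrable P volume s t :=
    hP.mono_set (by rw [uIcc_of_le (hs.1.trans hs.2)]; exact uIcc_subset_Icc hs ht)
  have h3 : ∫ τ in s..t, Real.exp (b * τ) * (a * P τ + b * Te) ≤
      ∫ τ in s..t, Real.exp (b * τ) * (b * Tc) := by
    refine intervalIntegral.integral_mono_ae_restrict hst (exp_mul_intervalIntegrable a b Te hi)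
      (Continuous.intervalIntegrable (by fun_prop) _ _) ?_
    rw [Filter.EventuallyLE, ae_restrict_iff' measurableSet_Icc]
    have h0 : ∀ᵐ x : ℝ, x ≠ s := by simp [ae_iff]
    filter_upwards [hle, h0] with τ hτ hne hm
    have := hτ ⟨lt_of_le_of_ne hm.1 hne.symm, hm.2⟩
    rw [le_div_iff₀ ha] at this
    exact mul_le_mul_of_nonneg_left (by linarith) (Real.exp_pos _).le
  linarith

/-- The derivative of `exp (b t) * (T - Tc)` is `exp (b t) * (a P - b (Tc - Te))`, here nonnegative.
-/
theorem le_temperature_of_ge {a b Te Tc T0 D : ℝ} (ha : 0 < a) {P : ℝ → ℝ}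
    (hP : IntervalIntegrable P volume 0 D) {s t : ℝ} (hs : s ∈ Icc 0 D) (ht : t ∈ Icc 0 D)
    (hst : s ≤ t) (hle : ∀ᵐ τ, τ ∈ Ioc s t → (Tc - Te) * b / a ≤ P τ) :
    Real.exp (b * s) * (temperature a b Te T0 P s - Tc) ≤
      Real.exp (b * t) * (temperature a b Te T0 P t - Tc) := by
  have h1 := exp_mul_temperature_sub a b Te T0 D hP hs ht
  have h2 := integral_exp_mul_const b Tc s t
  have hi : IntervalIntegrable P volume s t :=
    hP.mono_set (by rw [uIcc_of_le (hs.1.trans hs.2)]; exact uIcc_subset_Icc hs ht)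
  have h3 : ∫ τ in s..t, Real.exp (b * τ) * (b * Tc) ≤
      ∫ τ in s..t, Real.exp (b * τ) * (a * P τ + b * Te) := by
    refine intervalIntegral.integral_mono_ae_restrict hst
      (Continuous.intervalIntegrable (by fun_prop) _ _) (exp_mul_intervalIntegrable a b Te hi) ?_
    rw [Filter.EventuallyLE, ae_restrict_iff' measurableSet_Icc]
    have h0 : ∀ᵐ x : ℝ, x ≠ s := by simp [ae_iff]
    filter_upwards [hle, h0] with τ hτ hne hm
    have := hτ ⟨lt_of_le_of_ne hm.1 hne.symm, hm.2⟩
    rw [div_le_iff₀ ha] at this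
    exact mul_le_mul_of_nonneg_left (by linarith) (Real.exp_pos _).le
  linarith

/-! ### Concavity of the throughput and uniqueness of the optimum. -/

theorem log_one_add_integrableOn {P : ℝ → ℝ} {S : Set ℝ} (hS : MeasurableSet S)
    (hi : IntegrableOn P S) (h0 : ∀ t ∈ S, 0 ≤ P t) :
    IntegrableOn (fun t => Real.log (1 + P t)) S := by
  refine Integrable.mono' hi ?_ ?_
  · exact (Real.measurable_log.comp_aemeasurable
      (hi.aestronglyMeasurable.aemeasurable.const_add 1)).aestronglyMeasurable
  · refine (ae_restrict_iff' hS).2 (Filter.Eventually.of_forall fun t ht => ?_)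
    have := h0 t ht
    rw [Real.norm_of_nonneg (Real.log_nonneg (by linarith))]
    have := Real.log_le_sub_one_of_pos (show 0 < 1 + P t by linarith)
    linarith

theorem throughput_eq (D : ℝ) (P : ℝ → ℝ) :
    throughput D P = (2 * Real.log 2)⁻¹ * ∫ τ in (0 : ℝ)..D, Real.log (1 + P τ) := by
  rw [throughput, ← intervalIntegral.integral_const_mul]
  congr 1; ext τ
  rw [Real.logb, mul_inv]; ring

theorem throughput_le_iff (D : ℝ) (P Q : ℝ → ℝ) : throughput D P ≤ throughput D Q ↔
    ∫ τ in (0 : ℝ)..D, Real.log (1 + P τ) ≤ ∫ τ in (0 : ℝ)..D, Real.log (1 + Q τ) := by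
  rw [throughput_eq, throughput_eq]
  exact mul_le_mul_iff_right₀ (inv_pos.2 (mul_pos two_pos (Real.log_pos one_lt_two)))

/-- For nonnegative powers only the total energy has to be checked. -/
theorem isFeasiblePolicy_of_total {a b Te Tc T0 E D : ℝ} (hD : 0 < D) {P : ℝ → ℝ}
    (h0 : ∀ t ∈ Icc 0 D, 0 ≤ P t) (hi : IntervalIntegrable P volume 0 D)
    (hE : ∫ τ in (0 : ℝ)..D, P τ ≤ E) (hT : ∀ t ∈ Icc 0 D, temperature a b Te T0 P t ≤ Tc) :
    IsFeasiblePolicy a b Te Tc T0 E D P := by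
  refine ⟨h0, (intervalIntegrable_iff_integrableOn_Icc_of_le hD.le).1 hi, fun t ht => ?_, hT⟩
  refine le_trans ?_ hE
  refine intervalIntegral.integral_mono_interval le_rfl ht.1 ht.2 ?_ hi
  exact (ae_restrict_iff' measurableSet_Ioc).2
    (Filter.Eventually.of_forall fun t ht => h0 t ⟨ht.1.le, ht.2⟩)

theorem avg_log_le_log_avg {p q : ℝ} (hp : 0 ≤ p) (hq : 0 ≤ q) :
    Real.log (1 + p) / 2 + Real.log (1 + q) / 2 ≤ Real.log (1 + (p + q) / 2) ∧
      (Real.log (1 + (p + q) / 2) ≤ Real.log (1 + p) / 2 + Real.log (1 + q) / 2 → p = q) := by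
  have key : p ≠ q →
      Real.log (1 + p) / 2 + Real.log (1 + q) / 2 < Real.log (1 + (p + q) / 2) := by
    intro hne
    have h := strictConcaveOn_log_Ioi.2 (show (1 + p) ∈ Ioi (0 : ℝ) by simp; linarith)
      (show (1 + q) ∈ Ioi (0 : ℝ) by simp; linarith) (by simpa using hne)
      (show (0 : ℝ) < 1 / 2 by norm_num) (show (0 : ℝ) < 1 / 2 by norm_num) (by norm_num)
    simp only [smul_eq_mul] at h
    rw [show 1 / 2 * (1 + p) + 1 / 2 * (1 + q) = 1 + (p + q) / 2 by ring] at h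
    linarith
  constructor
  · by_cases hne : p = q
    · subst hne
      rw [add_self_div_two]; linarith
    · exact (key hne).le
  · intro h
    by_contra hne
    exact absurd h (not_le.2 (key hne))

theorem log_one_add_le_tangent {p q : ℝ} (hp : 0 ≤ p) (hq : 0 ≤ q) :
    Real.log (1 + p) ≤ Real.log (1 + q) + (p - q) / (1 + q) := by
  have h := Real.log_le_sub_one_of_pos (show 0 < (1 + p) / (1 + q) by positivity)
  rw [Real.log_div (by positivity) (by positivity)] at h
  have : (1 + p) / (1 + q) - 1 = (p - q) / (1 + q) := by field_simp; ring
  linarith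

theorem log_one_add_intervalIntegrable {P : ℝ → ℝ} {D s t : ℝ}
    (h0 : ∀ t ∈ Icc 0 D, 0 ≤ P t) (hi : IntervalIntegrable P volume s t)
    (hs : s ∈ Icc 0 D) (ht : t ∈ Icc 0 D) :
    IntervalIntegrable (fun t => Real.log (1 + P t)) volume s t := by
  rw [intervalIntegrable_iff] at hi ⊢
  refine log_one_add_integrableOn measurableSet_uIoc hi fun x hx => h0 x ?_
  exact uIcc_subset_Icc hs ht (uIoc_subset_uIcc hx)

/-- The midpoint of two feasible policies is feasible. -/
theorem IsFeasiblePolicy.midpoint {a b Te Tc T0 E D : ℝ} (hD : 0 < D) {P Q : ℝ → ℝ}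
    (hP : IsFeasiblePolicy a b Te Tc T0 E D P) (hQ : IsFeasiblePolicy a b Te Tc T0 E D Q) :
    IsFeasiblePolicy a b Te Tc T0 E D (fun t => (P t + Q t) / 2) := by
  have m0 : (0 : ℝ) ∈ Icc 0 D := ⟨le_rfl, hD.le⟩
  have iP := fun t ht => hP.intervalIntegrable hD m0 (t := t) ht
  have iQ := fun t ht => hQ.intervalIntegrable hD m0 (t := t) ht
  refine ⟨fun t ht => ?_, (hP.integrableOn.add hQ.integrableOn).div_const 2, fun t ht => ?_,
    fun t ht => ?_⟩
  · have := hP.nonneg t ht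
    have := hQ.nonneg t ht
    linarith
  · rw [intervalIntegral.integral_div, intervalIntegral.integral_add (iP t ht) (iQ t ht)]
    have := hP.energy_le t ht
    have := hQ.energy_le t ht
    linarith
  · have h1 := temperature_sub a b Te T0 (iP t ht)
      (((iP t ht).add (iQ t ht)).div_const 2)
    have h2 := temperature_sub a b Te T0 (iP t ht) (iQ t ht)
    have h3 : ∫ τ in (0 : ℝ)..t, Real.exp (b * τ) * ((P τ + Q τ) / 2 - P τ) =
        (∫ τ in (0 : ℝ)..t, Real.exp (b * τ) * (Q τ - P τ)) / 2 := by
      rw [← intervalIntegral.integral_div]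
      congr 1; ext τ; ring
    rw [h3] at h1
    have := hP.temperature_le t ht
    have := hQ.temperature_le t ht
    linarith

/-- An optimal policy is unique up to null sets. -/
theorem IsOptimalPolicy.ae_eq {a b Te Tc T0 E D : ℝ} (hD : 0 < D) {P Q : ℝ → ℝ}
    (hP : IsOptimalPolicy a b Te Tc T0 E D P) (hQ : IsFeasiblePolicy a b Te Tc T0 E D Q)
    (hle : ∫ τ in (0 : ℝ)..D, Real.log (1 + P τ) ≤ ∫ τ in (0 : ℝ)..D, Real.log (1 + Q τ)) :
    ∀ᵐ τ, τ ∈ Icc 0 D → Q τ = P τ := by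
  have m0 : (0 : ℝ) ∈ Icc 0 D := ⟨le_rfl, hD.le⟩
  have mD : D ∈ Icc 0 D := ⟨hD.le, le_rfl⟩
  have hM := hP.feasible.midpoint hD hQ
  have lP := log_one_add_intervalIntegrable hP.feasible.nonneg
    (hP.feasible.intervalIntegrable hD m0 mD) m0 mD
  have lQ := log_one_add_intervalIntegrable hQ.nonneg (hQ.intervalIntegrable hD m0 mD) m0 mD
  have lM := log_one_add_intervalIntegrable hM.nonneg (hM.intervalIntegrable hD m0 mD) m0 mD
  have h1 := (throughput_le_iff _ _ _).1 (hP.throughput_le _ hM)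
  have hi := (lM.sub ((lP.div_const 2).add (lQ.div_const 2)))
  -- The concavity gap is pointwise nonnegative, while optimality against the midpoint makes its
  -- integral nonpositive; it therefore vanishes almost everywhere.
  have h2 : ∫ τ in (0 : ℝ)..D, (Real.log (1 + (P τ + Q τ) / 2) -
      (Real.log (1 + P τ) / 2 + Real.log (1 + Q τ) / 2)) ≤ 0 := by
    rw [intervalIntegral.integral_sub lM ((lP.div_const 2).add (lQ.div_const 2)),
      intervalIntegral.integral_add (lP.div_const 2) (lQ.div_const 2),
      intervalIntegral.integral_div, intervalIntegral.integral_div]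
    linarith
  rw [intervalIntegral.integral_of_le hD.le, ← integral_Icc_eq_integral_Ioc] at h2
  have h3 : 0 ≤ᵐ[volume.restrict (Icc 0 D)] fun τ => Real.log (1 + (P τ + Q τ) / 2) -
      (Real.log (1 + P τ) / 2 + Real.log (1 + Q τ) / 2) := by
    refine (ae_restrict_iff' measurableSet_Icc).2 (Filter.Eventually.of_forall fun t ht => ?_)
    exact sub_nonneg.2 (avg_log_le_log_avg (hP.feasible.nonneg t ht) (hQ.nonneg t ht)).1
  have h4 := (integral_eq_zero_iff_of_nonneg_ae h3
    ((intervalIntegrable_iff_integrableOn_Icc_of_le hD.le).1 hi)).1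
    (le_antisymm h2 (integral_nonneg_of_ae h3))
  filter_upwards [(ae_restrict_iff' measurableSet_Icc).1 h4] with t ht hm
  exact ((avg_log_le_log_avg (hP.feasible.nonneg t hm) (hQ.nonneg t hm)).2
    (sub_eq_zero.1 (ht hm)).le).symm

/-- Jensen's inequality through the tangent at `q`. The correction vanishes when `q` is the average
of `P`, and is nonpositive when `q` exceeds it. -/
theorem integral_log_le_tangent {P : ℝ → ℝ} {D s q : ℝ} (h0 : ∀ t ∈ Icc 0 D, 0 ≤ P t)
    (hs : s ∈ Icc 0 D) (hi : IntervalIntegrable P volume s D) (hq : 0 ≤ q) :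
    ∫ τ in s..D, Real.log (1 + P τ) ≤
      (D - s) * Real.log (1 + q) + ((∫ τ in s..D, P τ) - (D - s) * q) / (1 + q) := by
  have mD : D ∈ Icc 0 D := ⟨hs.1.trans hs.2, le_rfl⟩
  have i2 : IntervalIntegrable (fun τ => (P τ - q) / (1 + q)) volume s D :=
    (hi.sub intervalIntegrable_const).div_const _
  have h := intervalIntegral.integral_mono_on hs.2 (log_one_add_intervalIntegrable h0 hi hs mD)
    (intervalIntegrable_const.add i2) fun t ht =>
      log_one_add_le_tangent (h0 t ⟨hs.1.trans ht.1, ht.2⟩) hq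
  refine h.trans_eq ?_
  rw [intervalIntegral.integral_add intervalIntegrable_const i2, intervalIntegral.integral_div,
    intervalIntegral.integral_sub hi intervalIntegrable_const]
  simp

/-! ### Averaging the remaining power. -/

/-- Starting at the critical temperature, the average power over the remaining time is at most the
power which keeps that temperature. -/
theorem IsFeasiblePolicy.integral_le_of_temperature_eq {a b Te Tc T0 E D : ℝ} (ha : 0 < a)
    (hb : 0 ≤ b) (hD : 0 < D) {P : ℝ → ℝ} (hP : IsFeasiblePolicy a b Te Tc T0 E D P) {s : ℝ}
    (hs : s ∈ Icc 0 D) (hTs : temperature a b Te T0 P s = Tc) :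
    ∫ τ in s..D, P τ ≤ (D - s) * ((Tc - Te) * b / a) := by
  have mD : D ∈ Icc 0 D := ⟨hD.le, le_rfl⟩
  have m0 : (0 : ℝ) ∈ Icc 0 D := ⟨le_rfl, hD.le⟩
  have i0 := hP.intervalIntegrable hD m0 mD
  have is := hP.intervalIntegrable hD hs mD
  have h1 := temperature_sub_eq_integral a b Te T0 D hD i0 hs mD
  have hTi : IntervalIntegrable (fun τ => b * (temperature a b Te T0 P τ - Te)) volume s D := by
    refine ContinuousOn.intervalIntegrable ?_
    refine continuousOn_const.mul (((temperature_continuousOn a b Te T0 D hD.le i0).mono ?_).sub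
      continuousOn_const)
    exact uIcc_subset_Icc hs mD
  rw [intervalIntegral.integral_sub (is.const_mul a) hTi, intervalIntegral.integral_const_mul] at h1
  have h2 : ∫ τ in s..D, b * (temperature a b Te T0 P τ - Te) ≤ ∫ τ in s..D, b * (Tc - Te) := by
    refine intervalIntegral.integral_mono_on hs.2 hTi intervalIntegrable_const fun t ht => ?_
    have := hP.temperature_le t ⟨hs.1.trans ht.1, ht.2⟩
    exact mul_le_mul_of_nonneg_left (by linarith) hb
  rw [intervalIntegral.integral_const, smul_eq_mul] at h2
  have h3 := hP.temperature_le D mD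
  have h4 : (∫ τ in s..D, P τ) * a ≤ (D - s) * (b * (Tc - Te)) := by nlinarith
  calc ∫ τ in s..D, P τ ≤ (D - s) * (b * (Tc - Te)) / a := by rwa [le_div_iff₀ ha]
    _ = _ := by ring

/-- If the average power of an optimal policy over the remaining time is at most the power which
keeps the critical temperature, then the policy is constant from now on. -/
theorem IsOptimalPolicy.ae_eq_average {a b Te Tc T0 E D : ℝ} (ha : 0 < a) (hD : 0 < D)
    {P : ℝ → ℝ} (hP : IsOptimalPolicy a b Te Tc T0 E D P) {s : ℝ} (hs : s ∈ Icc 0 D) (hsD : s < D)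
    {q : ℝ} (hq : ∫ τ in s..D, P τ = (D - s) * q) (hqc : q ≤ (Tc - Te) * b / a) :
    ∀ᵐ τ, τ ∈ Ioc s D → P τ = q := by
  have mD : D ∈ Icc 0 D := ⟨hD.le, le_rfl⟩
  have m0 : (0 : ℝ) ∈ Icc 0 D := ⟨le_rfl, hD.le⟩
  have hPf := hP.feasible
  have hq0 : 0 ≤ q := by
    have : 0 ≤ ∫ τ in s..D, P τ := intervalIntegral.integral_nonneg hs.2 fun t ht =>
      hPf.nonneg t ⟨hs.1.trans ht.1, ht.2⟩
    rw [hq] at this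
    exact nonneg_of_mul_nonneg_right this (by linarith)
  -- The competitor follows `P` up to `s` and then spends the same remaining energy at constant
  -- rate; `hqc` keeps it below `Tc`.
  set Q : ℝ → ℝ := fun τ => if τ ≤ s then P τ else q with hQ
  have e1 : ∀ u ≤ s, EqOn P Q (Ioc 0 u) := fun u hu τ hτ => by simp [hQ, hτ.2.trans hu]
  have e2 : EqOn (fun _ => q) Q (Ioc s D) := fun τ hτ => by simp [hQ, hτ.1]
  have i1 : IntervalIntegrable Q volume 0 s :=
    (hPf.intervalIntegrable hD m0 hs).congr (by rw [uIoc_of_le hs.1]; exact e1 s le_rfl)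
  have i2 : IntervalIntegrable Q volume s D :=
    (intervalIntegrable_const (c := q)).congr (by rw [uIoc_of_le hs.2]; exact e2)
  have iQ := i1.trans i2
  have n0 : ∀ t ∈ Icc 0 D, 0 ≤ Q t := by
    intro t ht
    simp only [hQ]
    split_ifs
    exacts [hPf.nonneg t ht, hq0]
  have c1 : ∀ f : ℝ → ℝ, ∫ τ in (0 : ℝ)..s, f (Q τ) = ∫ τ in (0 : ℝ)..s, f (P τ) := fun f =>
    intervalIntegral.integral_congr_ae (Filter.Eventually.of_forall fun t ht => by
      rw [uIoc_of_le hs.1] at ht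
      rw [e1 s le_rfl ht])
  have c2 : ∀ f : ℝ → ℝ, ∫ τ in s..D, f (Q τ) = (D - s) * f q := fun f => by
    rw [intervalIntegral.integral_congr_ae (g := fun _ => f q)
      (Filter.Eventually.of_forall fun t ht => by
        rw [uIoc_of_le hs.2] at ht
        rw [← e2 ht]), intervalIntegral.integral_const, smul_eq_mul]
  have iP1 := hPf.intervalIntegrable hD m0 hs
  have iP2 := hPf.intervalIntegrable hD hs mD
  have hQf : IsFeasiblePolicy a b Te Tc T0 E D Q := by
    refine isFeasiblePolicy_of_total hD n0 iQ ?_ fun t ht => ?_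
    · have := hPf.energy_le D mD
      rw [← intervalIntegral.integral_add_adjacent_intervals iP1 iP2] at this
      rw [← intervalIntegral.integral_add_adjacent_intervals i1 i2]
      have h1 := c1 id
      have h2 := c2 id
      simp only [id] at h1 h2
      rw [h1, h2, ← hq]; exact this
    · have hsT : ∀ u ∈ Icc 0 s, temperature a b Te T0 Q u ≤ Tc := fun u hu => by
        rw [temperature_congr a b Te T0 hu.1 (Filter.Eventually.of_forall fun x hx =>
          (e1 u hu.2 hx).symm)]
        exact hPf.temperature_le u ⟨hu.1, hu.2.trans hs.2⟩
      rcases le_total t s with hts | hts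
      · exact hsT t ⟨ht.1, hts⟩
      · have h := temperature_le_of_le (Tc := Tc) (Te := Te) (b := b) (T0 := T0) ha iQ hs ht hts
          (Filter.Eventually.of_forall fun x hx => by
            rw [← e2 ⟨hx.1, hx.2.trans ht.2⟩]; exact hqc)
        have h2 := mul_nonpos_of_nonneg_of_nonpos (Real.exp_pos (b * s)).le
          (sub_nonpos.2 (hsT s ⟨hs.1, le_rfl⟩))
        have h3 := nonpos_of_mul_nonpos_right (h.trans h2) (Real.exp_pos (b * t))
        linarith
  have hU := hP.ae_eq hD hQf (by
    have lP := log_one_add_intervalIntegrable hPf.nonneg iP1 m0 hs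
    have lP2 := log_one_add_intervalIntegrable hPf.nonneg iP2 hs mD
    have lQ := log_one_add_intervalIntegrable n0 i1 m0 hs
    have lQ2 := log_one_add_intervalIntegrable n0 i2 hs mD
    rw [← intervalIntegral.integral_add_adjacent_intervals lP lP2,
      ← intervalIntegral.integral_add_adjacent_intervals lQ lQ2]
    have h1 := c1 fun p => Real.log (1 + p)
    have h2 := c2 fun p => Real.log (1 + p)
    have h3 := integral_log_le_tangent hPf.nonneg hs iP2 hq0
    rw [hq, sub_self, zero_div, add_zero] at h3
    rw [h1, h2]
    linarith)
  filter_upwards [hU] with t ht hm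
  rw [← ht ⟨hs.1.trans hm.1.le, hm.2⟩, ← e2 hm]

/-- When starting at the critical temperature, a constant policy is optimal. -/
theorem isOptimalPolicy_const {a b Te Tc E D : ℝ} (ha : 0 < a) (hb : 0 ≤ b) (hTc : Te < Tc)
    (hE : 0 ≤ E) (hD : 0 < D) :
    IsOptimalPolicy a b Te Tc Tc E D (fun _ => min ((Tc - Te) * b / a) (E / D)) := by
  have mD : D ∈ Icc 0 D := ⟨hD.le, le_rfl⟩
  have m0 : (0 : ℝ) ∈ Icc 0 D := ⟨le_rfl, hD.le⟩
  set q := min ((Tc - Te) * b / a) (E / D) with hq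
  have hq0 : 0 ≤ q := le_min (div_nonneg (mul_nonneg (by linarith) hb) ha.le) (by positivity)
  refine ⟨isFeasiblePolicy_of_total hD (fun _ _ => hq0) intervalIntegrable_const ?_ ?_, ?_⟩
  · rw [intervalIntegral.integral_const, smul_eq_mul, sub_zero, mul_comm, ← le_div_iff₀ hD]
    exact min_le_right _ _
  · intro t ht
    have h := temperature_le_of_le (Tc := Tc) (Te := Te) (b := b) (T0 := Tc) (D := D)
      (P := fun _ => q) ha intervalIntegrable_const m0 ht ht.1
      (Filter.Eventually.of_forall fun x _ => min_le_left _ _)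
    rw [temperature_zero, sub_self, mul_zero] at h
    linarith [nonpos_of_mul_nonpos_right h (Real.exp_pos (b * t))]
  · intro P hP
    rw [throughput_le_iff]
    have iP := hP.intervalIntegrable hD m0 mD
    have h1 := integral_log_le_tangent hP.nonneg m0 iP hq0
    have h2 := hP.integral_le_of_temperature_eq ha hb hD m0 (temperature_zero _ _ _ _ _)
    have h3 := hP.energy_le D mD
    -- The two terms of the minimum are the bounds on the average power imposed by temperature and
    -- by energy.
    have h4 : ∫ τ in (0 : ℝ)..D, P τ ≤ (D - 0) * q := by
      rw [sub_zero, mul_comm, ← div_le_iff₀ hD, hq]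
      refine le_min ?_ (div_le_div_of_nonneg_right h3 hD.le)
      rw [div_le_iff₀ hD]; linarith
    have h5 : ((∫ τ in (0 : ℝ)..D, P τ) - (D - 0) * q) / (1 + q) ≤ 0 :=
      div_nonpos_of_nonpos_of_nonneg (by linarith) (by linarith)
    rw [intervalIntegral.integral_const, smul_eq_mul]
    linarith

/-! ### Behaviour after the critical temperature is reached. -/

theorem primitive_continuousOn {P : ℝ → ℝ} {D : ℝ} (hD : 0 ≤ D)
    (hP : IntervalIntegrable P volume 0 D) :
    ContinuousOn (fun t => ∫ τ in (0 : ℝ)..t, P τ) (Icc 0 D) := by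
  have := (hP.absolutelyContinuousOnInterval_intervalIntegral (c := 0) (by simp)).continuousOn
  rwa [uIcc_of_le hD] at this

/-- Once the critical temperature is reached, an optimal policy keeps it. -/
theorem IsOptimalPolicy.ae_eq_after_critical {a b Te Tc T0 E D : ℝ} (ha : 0 < a) (hb : 0 ≤ b)
    (hD : 0 < D) (hT0 : T0 < Tc) {P : ℝ → ℝ} (hP : IsOptimalPolicy a b Te Tc T0 E D P) {s : ℝ}
    (hs : IsLeast {t | t ∈ Icc 0 D ∧ temperature a b Te T0 P t = Tc} s) (hsD : s < D) :
    ∀ᵐ τ, τ ∈ Ioc s D → P τ = (Tc - Te) * b / a := by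
  obtain ⟨⟨hsI, hTs⟩, hleast⟩ := hs
  have mD : D ∈ Icc 0 D := ⟨hD.le, le_rfl⟩
  have m0 : (0 : ℝ) ∈ Icc 0 D := ⟨le_rfl, hD.le⟩
  have iP := hP.feasible.intervalIntegrable hD m0 mD
  have hs0 : 0 < s := by
    refine lt_of_le_of_ne hsI.1 fun h => ?_
    rw [← h, temperature_zero] at hTs
    exact hT0.ne hTs
  set c := (Tc - Te) * b / a with hc
  have hle := hP.feasible.integral_le_of_temperature_eq ha hb hD hsI hTs
  rw [← hc] at hle
  rcases hle.lt_or_eq with hlt | heq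
  · exfalso
    -- `G t < 0` says that the average power after `t` is below `c`. By continuity this persists at
    -- some `r < s`, where averaging forces the temperature to equal `Tc` already.
    set G : ℝ → ℝ := fun t => ((∫ τ in (0 : ℝ)..D, P τ) - ∫ τ in (0 : ℝ)..t, P τ) - (D - t) * c
    have hG : ∀ t ∈ Icc 0 D, G t = (∫ τ in t..D, P τ) - (D - t) * c := fun t ht => by
      simp only [G]
      rw [intervalIntegral.integral_interval_sub_left iP (hP.feasible.intervalIntegrable hD m0 ht)]
    have hcont : ContinuousOn G (Icc 0 D) :=
      (continuousOn_const.sub (primitive_continuousOn hD.le iP)).sub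
        (Continuous.continuousOn (by fun_prop))
    have hGs : G s < 0 := by rw [hG s hsI]; linarith
    have hev := (hcont s hsI).eventually_lt_const hGs
    have hev2 : ∀ᶠ t in nhdsWithin s (Ioo 0 s), G t < 0 :=
      hev.filter_mono (nhdsWithin_mono _
        (show Ioo 0 s ⊆ Icc 0 D from fun t ht => ⟨ht.1.le, ht.2.le.trans hsI.2⟩))
    have : (nhdsWithin s (Ioo 0 s)).NeBot := right_nhdsWithin_Ioo_neBot hs0
    obtain ⟨r, hr, hrI⟩ := (hev2.and self_mem_nhdsWithin).exists
    have hrD : r ∈ Icc 0 D := ⟨hrI.1.le, hrI.2.le.trans hsI.2⟩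
    rw [hG r hrD] at hr
    have hpos : 0 < D - r := by linarith [hrI.2]
    have h1 := hP.ae_eq_average ha hD hrD (by linarith [hrI.2])
      (q := (∫ τ in r..D, P τ) / (D - r)) (by field_simp)
      (by rw [div_le_iff₀ hpos, ← hc]; linarith)
    have h2 := temperature_le_of_le (Tc := Tc) (Te := Te) (b := b) (T0 := T0) ha iP hrD hsI
      hrI.2.le (by
        filter_upwards [h1] with t ht hm
        rw [ht ⟨hm.1, hm.2.trans hsI.2⟩, div_le_iff₀ hpos, ← hc]
        linarith)
    rw [hTs, sub_self, mul_zero] at h2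
    have h3 := nonneg_of_mul_nonneg_right h2 (Real.exp_pos _)
    have h4 := hP.feasible.temperature_le r hrD
    have hTr : temperature a b Te T0 P r = Tc := by
      linarith
    have h5 : s ≤ r := hleast ⟨hrD, hTr⟩
    linarith [hrI.2]
  · exact hP.ae_eq_average ha hD hsI hsD heq le_rfl

/-! ### Moving power to an earlier time. -/

section Exchange

variable {v : ℝ → ℝ} {x h d b t : ℝ}

theorem exp_mul_integrable (hv : Integrable v) (hsupp : ∀ τ, τ ∉ Ioc x (x + h) → v τ = 0)
    (e : ℝ) : Integrable (fun τ => Real.exp (b * τ + e) * v τ) := by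
  have h1 : IntegrableOn (fun τ => Real.exp (b * τ + e) * v τ) (Icc x (x + h)) :=
    hv.integrableOn.continuousOn_mul (Continuous.continuousOn (by fun_prop)) isCompact_Icc
  refine (integrableOn_iff_integrable_of_support_subset fun τ hτ => ?_).1 h1
  by_contra hn
  exact hτ (by simp [hsupp τ fun hm => hn ⟨hm.1.le, hm.2⟩])

/-- Moving power by `d` earlier in time decreases the accumulated heat at later times. -/
theorem integral_exp_mul_shift_nonpos (hb : 0 ≤ b) (hd : 0 ≤ d) (hx : 0 ≤ x)
    (hv : Integrable v) (hv0 : ∀ τ, 0 ≤ v τ) (hsupp : ∀ τ, τ ∉ Ioc x (x + h) → v τ = 0)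
    (ht : x + h + d ≤ t) (ht0 : 0 ≤ t) :
    ∫ τ in (0 : ℝ)..t, Real.exp (b * τ) * (v τ - v (τ - d)) ≤ 0 := by
  have i0 := exp_mul_integrable (b := b) hv hsupp 0
  have i1 := exp_mul_integrable (b := b) hv hsupp (b * d)
  simp only [add_zero] at i0
  have i2 := i1.comp_sub_right d
  have hsimp : ∀ τ, Real.exp (b * (τ - d) + b * d) * v (τ - d) = Real.exp (b * τ) * v (τ - d) :=
    fun τ => by congr 2; ring
  simp only [hsimp] at i2
  have e : ∀ τ, Real.exp (b * τ) * (v τ - v (τ - d)) =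
      Real.exp (b * τ) * v τ - Real.exp (b * τ) * v (τ - d) := fun τ => by ring
  rw [intervalIntegral.integral_of_le ht0, setIntegral_eq_integral_of_forall_compl_eq_zero]
  · simp only [e]
    rw [integral_sub i0 i2]
    -- Translation puts both terms on the same window, with weights `exp (b τ)` and `exp (b (τ +
    -- d))`.
    have h1 := integral_sub_right_eq_self (μ := volume)
      (fun τ => Real.exp (b * τ + b * d) * v τ) d
    simp only [hsimp] at h1
    rw [h1, sub_nonpos]
    refine integral_mono i0 i1 fun τ => ?_
    exact mul_le_mul_of_nonneg_right (Real.exp_le_exp.2 (by nlinarith)) (hv0 τ)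
  · intro τ hτ
    rw [hsupp τ fun hm => hτ ⟨hx.trans_lt hm.1, hm.2.trans (by linarith)⟩,
      hsupp (τ - d) fun hm => hτ ⟨by linarith [hm.1], by linarith [hm.2]⟩]
    simp

/-- A crude bound, obtained by ignoring the removed power. It serves before the exchange is
complete, where slack in the temperature absorbs it. -/
theorem integral_exp_mul_shift_le (hb : 0 ≤ b)
    (hv : Integrable v) (hv0 : ∀ τ, 0 ≤ v τ) (ht0 : 0 ≤ t) :
    ∫ τ in (0 : ℝ)..t, Real.exp (b * τ) * (v τ - v (τ - d)) ≤ Real.exp (b * t) * ∫ τ, v τ := by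
  have i2 := hv.comp_sub_right d
  have h1 : ∫ τ in (0 : ℝ)..t, Real.exp (b * τ) * (v τ - v (τ - d)) ≤
      ∫ τ in (0 : ℝ)..t, Real.exp (b * t) * v τ := by
    refine intervalIntegral.integral_mono_on ht0 ?_ (hv.intervalIntegrable.const_mul _)
      fun τ hτ => ?_
    · exact (hv.sub i2).intervalIntegrable.continuousOn_mul (by fun_prop)
    · exact (mul_le_mul_of_nonneg_left (sub_le_self _ (hv0 _)) (Real.exp_pos _).le).trans
        (mul_le_mul_of_nonneg_right (Real.exp_le_exp.2 (mul_le_mul_of_nonneg_left hτ.2 hb)) (hv0 τ))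
  rw [intervalIntegral.integral_const_mul, intervalIntegral.integral_of_le (f := v) ht0] at h1
  refine h1.trans (mul_le_mul_of_nonneg_left ?_ (Real.exp_pos _).le)
  exact setIntegral_le_integral hv (Filter.Eventually.of_forall hv0)

end Exchange

/-- The transfer keeps the sum and, for `ε ≤ 1`, does not decrease the product of `1 + p` and `1 +
r`. -/
theorem log_add_log_le_exchange {p r ε : ℝ} (hp : 0 ≤ p) (hr : 0 ≤ r) (h0 : 0 ≤ ε) (h1 : ε ≤ 1) :
    Real.log (1 + p) + Real.log (1 + r) ≤
      Real.log (1 + (p + ε * max (r - p) 0)) + Real.log (1 + (r - ε * max (r - p) 0)) := by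
  rcases le_total r p with h | h
  · simp [max_eq_right (sub_nonpos.2 h)]
  · rw [max_eq_left (sub_nonneg.2 h)]
    have hu : 0 ≤ r - p := by linarith
    have h2 : 0 ≤ ε * (r - p) := mul_nonneg h0 hu
    have h3 : ε * (r - p) ≤ r - p := by nlinarith
    rw [← Real.log_mul (by linarith) (by linarith), ← Real.log_mul (by linarith) (by linarith)]
    exact Real.log_le_log (mul_pos (by linarith) (by linarith)) (by nlinarith)

/-- While the temperature is below the critical one, an optimal policy does not increase. -/
theorem IsOptimalPolicy.ae_shift_le {a b Te Tc T0 E D : ℝ} (ha : 0 < a) (hb : 0 ≤ b)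
    (hD : 0 < D) {P : ℝ → ℝ} (hP : IsOptimalPolicy a b Te Tc T0 E D P) {x h d : ℝ} (hx : 0 ≤ x)
    (hh : 0 < h) (hhd : h ≤ d) (hxD : x + h + d ≤ D)
    (hT : ∀ t ∈ Icc 0 (x + h + d), temperature a b Te T0 P t < Tc) :
    ∀ᵐ τ, τ ∈ Ioc x (x + h) → P (τ + d) ≤ P τ := by
  have mD : D ∈ Icc 0 D := ⟨hD.le, le_rfl⟩
  have m0 : (0 : ℝ) ∈ Icc 0 D := ⟨le_rfl, hD.le⟩
  have hPf := hP.feasible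
  have iP := hPf.intervalIntegrable hD m0 mD
  set v : ℝ → ℝ := (Ioc x (x + h)).indicator fun τ => max (P (τ + d) - P τ) 0 with hv
  have mx : x ∈ Icc 0 D := ⟨hx, by linarith⟩
  have mxh : x + h ∈ Icc 0 D := ⟨by linarith, by linarith⟩
  have mxd : x + d ∈ Icc 0 D := ⟨by linarith, by linarith⟩
  have mxhd : x + h + d ∈ Icc 0 D := ⟨by linarith, by linarith⟩
  have sub1 : Ioc x (x + h) ⊆ Icc 0 D := fun τ hτ => ⟨by linarith [hτ.1], by linarith [hτ.2]⟩
  have sub2 : Ioc (x + d) (x + h + d) ⊆ Icc 0 D := fun τ hτ =>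
    ⟨by linarith [hτ.1], by linarith [hτ.2]⟩
  have hvi : Integrable v := by
    have h1 : IntervalIntegrable (fun τ => P (τ + d)) volume x (x + h) :=
      by simpa using (hPf.intervalIntegrable hD mxd mxhd).comp_add_right d
    have h2 := h1.sub (hPf.intervalIntegrable hD mx mxh)
    rw [intervalIntegrable_iff, uIoc_of_le (by linarith)] at h2
    exact (integrable_indicator_iff measurableSet_Ioc).2 (Integrable.pos_part h2)
  have hv0 : ∀ τ, 0 ≤ v τ := fun τ => indicator_nonneg (fun _ _ => le_max_right _ _) τ
  have hsupp : ∀ τ, τ ∉ Ioc x (x + h) → v τ = 0 := fun τ hτ => indicator_of_notMem hτ _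
  have hval : ∀ τ ∈ Ioc x (x + h), v τ = max (P (τ + d) - P τ) 0 := fun τ hτ =>
    indicator_of_mem hτ _
  have hvP : ∀ τ ∈ Icc 0 D, v (τ - d) ≤ P τ := by
    intro τ hτ
    by_cases hm : τ - d ∈ Ioc x (x + h)
    · rw [hval _ hm, sub_add_cancel]
      exact max_le (by linarith [hPf.nonneg _ (sub1 hm)]) (hPf.nonneg τ hτ)
    · rw [hsupp _ hm]; exact hPf.nonneg τ hτ
  obtain ⟨m, hm, hmax⟩ := isCompact_Icc.exists_isMaxOn (nonempty_Icc.2 (by linarith))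
    ((temperature_continuousOn a b Te T0 D hD.le iP).mono
      (Icc_subset_Icc_right hxD : Icc 0 (x + h + d) ⊆ Icc 0 D))
  have hη := hT m hm
  have hV : 0 ≤ ∫ τ, v τ := integral_nonneg hv0
  have haV : 0 ≤ a * ∫ τ, v τ := mul_nonneg ha.le hV
  -- The exchange heats by at most `ε * a * ∫ v`, which must fit under the slack at the hottest time
  -- `m`. The `+ 1` in the witness covers `∫ v = 0`.
  obtain ⟨ε, hε0, hε1, hεV⟩ : ∃ ε : ℝ, 0 < ε ∧ ε ≤ 1 ∧
      ε * (a * ∫ τ, v τ) ≤ Tc - temperature a b Te T0 P m := by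
    refine ⟨min 1 ((Tc - temperature a b Te T0 P m) / (a * (∫ τ, v τ) + 1)),
      lt_min one_pos (div_pos (by linarith) (by linarith)), min_le_left _ _, ?_⟩
    refine (mul_le_mul_of_nonneg_right (min_le_right _ _) haV).trans ?_
    rw [div_mul_eq_mul_div, div_le_iff₀ (by linarith)]
    exact mul_le_mul_of_nonneg_left (by linarith) (by linarith)
  set Q : ℝ → ℝ := fun τ => P τ + ε * (v τ - v (τ - d)) with hQ
  have iw : Integrable fun τ => ε * (v τ - v (τ - d)) :=
    (hvi.sub (hvi.comp_sub_right d)).const_mul ε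
  have iQ : IntervalIntegrable Q volume 0 D := iP.add iw.intervalIntegrable
  have n0 : ∀ t ∈ Icc 0 D, 0 ≤ Q t := by
    intro t ht
    have h1 := hvP t ht
    have h2 := hv0 t
    have h3 := hv0 (t - d)
    simp only [hQ]
    nlinarith
  have hQf : IsFeasiblePolicy a b Te Tc T0 E D Q := by
    refine isFeasiblePolicy_of_total hD n0 iQ ?_ fun t ht => ?_
    -- With `b = 0` the heat estimate becomes the energy estimate.
    · have h1 := integral_exp_mul_shift_nonpos (b := 0) le_rfl (hh.le.trans hhd) hx hvi hv0 hsupp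
        hxD hD.le
      simp only [zero_mul, Real.exp_zero, one_mul] at h1
      simp only [hQ]
      rw [intervalIntegral.integral_add iP iw.intervalIntegrable,
        intervalIntegral.integral_const_mul]
      have h2 := mul_nonpos_of_nonneg_of_nonpos hε0.le h1
      linarith [hPf.energy_le D mD]
    · have iPt := hPf.intervalIntegrable hD m0 ht
      have iQt : IntervalIntegrable Q volume 0 t := iPt.add iw.intervalIntegrable
      have e1 : ∫ τ in (0 : ℝ)..t, Real.exp (b * τ) * (Q τ - P τ) =
          ε * ∫ τ in (0 : ℝ)..t, Real.exp (b * τ) * (v τ - v (τ - d)) := by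
        rw [← intervalIntegral.integral_const_mul]
        congr 1; ext τ; simp only [hQ]; ring
      rcases le_total t (x + h + d) with htx | htx
      · have h1 := temperature_sub a b Te T0 iPt iQt
        have h2 := integral_exp_mul_shift_le (d := d) hb hvi hv0 ht.1
        have h3 := mul_le_mul_of_nonneg_left h2 (Real.exp_pos (-(b * t))).le
        rw [← mul_assoc, ← Real.exp_add, neg_add_cancel, Real.exp_zero, one_mul] at h3
        have h4 := mul_le_mul_of_nonneg_left h3 (mul_nonneg ha.le hε0.le)
        have h5 : temperature a b Te T0 P t ≤ temperature a b Te T0 P m := hmax ⟨ht.1, htx⟩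
        rw [e1] at h1
        linarith
      · refine (temperature_le_of_integral_nonpos ha iPt iQt ?_).trans (hPf.temperature_le t ht)
        rw [e1]
        exact mul_nonpos_of_nonneg_of_nonpos hε0.le
          (integral_exp_mul_shift_nonpos hb (hh.le.trans hhd) hx hvi hv0 hsupp htx ht.1)
  have hU := hP.ae_eq hD hQf (by
    have lP := log_one_add_intervalIntegrable hPf.nonneg iP m0 mD
    have lQ := log_one_add_intervalIntegrable n0 iQ m0 mD
    rw [← sub_nonneg, ← intervalIntegral.integral_sub lQ lP]
    set f : ℝ → ℝ := fun τ => Real.log (1 + Q τ) - Real.log (1 + P τ) with hf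
    have fi : ∀ s ∈ Icc 0 D, ∀ t ∈ Icc 0 D, IntervalIntegrable f volume s t := fun s hs t ht =>
      (lQ.sub lP).mono_set (by rw [uIcc_of_le hD.le]; exact uIcc_subset_Icc hs ht)
    -- Only the two windows change, disjoint since `h ≤ d`. Translating the second onto the first
    -- pairs `τ` with `τ + d` for a pointwise comparison.
    have e1 : ∫ τ in (0 : ℝ)..D, f τ =
        (∫ τ in Ioc x (x + h), f τ) + ∫ τ in Ioc (x + d) (x + h + d), f τ := by
      rw [intervalIntegral.integral_of_le hD.le, ← setIntegral_union _ measurableSet_Ioc]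
      · refine setIntegral_eq_of_subset_of_forall_sdiff_eq_zero measurableSet_Ioc ?_ ?_
        · rintro τ (hτ | hτ) <;> exact ⟨by linarith [hτ.1], by linarith [hτ.2]⟩
        · rintro τ ⟨-, hτ⟩
          have h1 : τ ∉ Ioc x (x + h) := fun hn => hτ (Or.inl hn)
          have h2 : τ - d ∉ Ioc x (x + h) := fun hn =>
            hτ (Or.inr ⟨by linarith [hn.1], by linarith [hn.2]⟩)
          simp [hf, hQ, hsupp _ h1, hsupp _ h2]
      · have := (fi x mx _ mxh); rw [intervalIntegrable_iff, uIoc_of_le (by linarith)] at this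
        exact this
      · have := (fi _ mxd _ mxhd); rw [intervalIntegrable_iff, uIoc_of_le (by linarith)] at this
        exact this
      · rw [Set.disjoint_left]
        intro τ h1 h2
        linarith [h1.2, h2.1]
    have e2 : ∫ τ in x..(x + h), f (τ + d) = ∫ τ in (x + d)..(x + h + d), f τ :=
      intervalIntegral.integral_comp_add_right f d
    rw [e1, ← intervalIntegral.integral_of_le (by linarith),
      ← intervalIntegral.integral_of_le (by linarith), ← e2,
      ← intervalIntegral.integral_add (fi x mx _ mxh)
        (by simpa using (fi _ mxd _ mxhd).comp_add_right d)]
    rw [intervalIntegral.integral_of_le (by linarith)]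
    refine setIntegral_nonneg measurableSet_Ioc fun τ hτ => ?_
    have h1 : v (τ - d) = 0 := hsupp _ fun hn => by linarith [hn.1, hτ.2]
    have h2 : v (τ + d) = 0 := hsupp _ fun hn => by linarith [hn.2, hτ.1]
    have h3 := log_add_log_le_exchange (hPf.nonneg τ (sub1 hτ))
      (hPf.nonneg (τ + d) (sub2 ⟨by linarith [hτ.1], by linarith [hτ.2]⟩)) hε0.le hε1
    simp only [hf, hQ, h1, h2, add_sub_cancel_right, sub_zero, zero_sub, hval τ hτ, mul_neg,
      ← sub_eq_add_neg]
    linarith)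
  filter_upwards [hU] with τ hτ hm
  have h1 := hτ (sub1 hm)
  have h2 : v (τ - d) = 0 := hsupp _ fun hn => by linarith [hn.1, hm.2]
  simp only [hQ, h2, sub_zero, hval τ hm] at h1
  have h3 : max (P (τ + d) - P τ) 0 = 0 := by
    have : ε * max (P (τ + d) - P τ) 0 = 0 := by linarith
    exact (mul_eq_zero.1 this).resolve_left hε0.ne'
  linarith [le_max_left (P (τ + d) - P τ) 0]

/-! ### Bound on the initial energy rate. -/

theorem one_add_inv_intervalIntegrable {P : ℝ → ℝ} {D s t : ℝ}
    (h0 : ∀ t ∈ Icc 0 D, 0 ≤ P t) (hi : IntervalIntegrable P volume s t)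
    (hs : s ∈ Icc 0 D) (ht : t ∈ Icc 0 D) :
    IntervalIntegrable (fun t => (1 + P t)⁻¹) volume s t := by
  rw [intervalIntegrable_iff] at hi ⊢
  refine Integrable.mono' (g := fun _ => (1 : ℝ))
    (integrableOn_const (hs := by simp [uIoc])) ?_ ?_
  · exact (hi.aestronglyMeasurable.aemeasurable.const_add 1).inv.aestronglyMeasurable
  · refine (ae_restrict_iff' measurableSet_uIoc).2 (Filter.Eventually.of_forall fun x hx => ?_)
    have := h0 x (uIcc_subset_Icc hs ht (uIoc_subset_uIcc hx))
    rw [Real.norm_of_nonneg (by positivity)]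
    exact inv_le_one_of_one_le₀ (by linarith)

/-- Halving a power costs at most `log 2`, however large the power. -/
theorem log_one_add_half_ge {p : ℝ} (hp : 0 ≤ p) :
    Real.log (1 + p) - Real.log 2 ≤ Real.log (1 + p / 2) := by
  rw [← Real.log_div (by positivity) (by norm_num)]
  exact Real.log_le_log (by positivity) (by linarith)

/-- The bound `1 + p + δ ≤ (1 + δ) * (1 + p)` separates `δ` from `p`, so the gain integrates to a
fixed multiple of `δ / (1 + δ)`. -/
theorem log_one_add_add_ge {p δ : ℝ} (hp : 0 ≤ p) (hδ : 0 ≤ δ) :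
    Real.log (1 + p) + δ / (1 + δ) * (1 + p)⁻¹ ≤ Real.log (1 + (p + δ)) := by
  have h1 := log_one_add_le_tangent hp (show 0 ≤ p + δ by positivity)
  have h2 : δ / (1 + δ) * (1 + p)⁻¹ ≤ δ / (1 + (p + δ)) := by
    rw [← div_eq_mul_inv, div_div]
    exact div_le_div_of_nonneg_left hδ (by positivity) (by nlinarith [mul_nonneg hp hδ])
  have h3 : (p - (p + δ)) / (1 + (p + δ)) = -(δ / (1 + (p + δ))) := by ring
  rw [h3] at h1
  linarith

/-- An optimal policy spends energy at a bounded rate initially. -/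
theorem IsOptimalPolicy.exists_integral_le {a b Te Tc T0 E D : ℝ} (ha : 0 < a) (hb : 0 ≤ b)
    (hD : 0 < D) {P : ℝ → ℝ} (hP : IsOptimalPolicy a b Te Tc T0 E D P) :
    ∃ C : ℝ, ∀ h : ℝ, 0 < h → h ≤ D / 2 → ∫ τ in (0 : ℝ)..h, P τ ≤ C * h := by
  have mD : D ∈ Icc 0 D := ⟨hD.le, le_rfl⟩
  have m0 : (0 : ℝ) ∈ Icc 0 D := ⟨le_rfl, hD.le⟩
  have mH : D / 2 ∈ Icc 0 D := ⟨by linarith, by linarith⟩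
  have hPf := hP.feasible
  have iP := hPf.intervalIntegrable hD m0 mD
  have iI := one_add_inv_intervalIntegrable hPf.nonneg (hPf.intervalIntegrable hD mH mD) mH mD
  set W := ∫ τ in (D / 2)..D, (1 + P τ)⁻¹ with hW
  have hWpos : 0 < W := by
    refine intervalIntegral.intervalIntegral_pos_of_pos_on iI (fun t ht => ?_) (by linarith)
    have := hPf.nonneg t ⟨by linarith [ht.1], ht.2.le⟩
    positivity
  refine ⟨Real.log 2 * (1 + E * Real.exp (-(b * D)) / D) * D * Real.exp (b * D) / W,
    fun h hh hhD => ?_⟩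
  have mh : h ∈ Icc 0 D := ⟨hh.le, by linarith⟩
  set m := ∫ τ in (0 : ℝ)..h, P τ with hm
  have hm0 : 0 ≤ m := intervalIntegral.integral_nonneg hh.le fun t ht =>
    hPf.nonneg t ⟨ht.1, ht.2.trans mh.2⟩
  have hmE : m ≤ E := hPf.energy_le h mh
  -- The competitor halves the power on `(0, h]` and adds `δ` on `(D/2, D]`. Even with the largest
  -- weight `exp (b * D)`, the added `δ * D / 2` amounts to `m / 2`, exactly the energy removed.
  set δ := m * Real.exp (-(b * D)) / D with hδ
  have hδ0 : 0 ≤ δ := by positivity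
  have hδm : Real.exp (b * D) * δ * D = m := by
    have : Real.exp (b * D) * Real.exp (-(b * D)) = 1 := by rw [← Real.exp_add]; simp
    rw [hδ]; field_simp; linear_combination m * this
  set u : ℝ → ℝ := (Ioc 0 h).indicator fun τ => P τ / 2 with hu
  set w : ℝ → ℝ := (Ioc (D / 2) D).indicator fun _ => δ with hw
  have sub1 : Ioc 0 h ⊆ Ioc 0 D := Ioc_subset_Ioc_right mh.2
  have sub2 : Ioc (D / 2) D ⊆ Ioc 0 D := Ioc_subset_Ioc_left mH.1
  have ui : Integrable u := by
    refine (integrable_indicator_iff measurableSet_Ioc).2 ?_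
    have := (hPf.intervalIntegrable hD m0 mh).div_const 2
    rwa [intervalIntegrable_iff, uIoc_of_le hh.le] at this
  have wi : Integrable w := (integrable_indicator_iff measurableSet_Ioc).2
    (integrableOn_const (hs := by simp))
  have u0 : ∀ τ, 0 ≤ u τ := fun τ => indicator_nonneg (fun t ht => by
    have := hPf.nonneg t ⟨ht.1.le, ht.2.trans mh.2⟩
    positivity) τ
  have w0 : ∀ τ, 0 ≤ w τ := fun τ => indicator_nonneg (fun _ _ => hδ0) τ
  have huInt : ∀ t, h ≤ t → ∫ τ in (0 : ℝ)..t, u τ = m / 2 := fun t ht => by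
    rw [intervalIntegral.integral_of_le (hh.le.trans ht), setIntegral_indicator measurableSet_Ioc,
      inter_eq_self_of_subset_right (Ioc_subset_Ioc_right ht),
      ← intervalIntegral.integral_of_le hh.le, intervalIntegral.integral_div]
  have hwInt : ∫ τ in (0 : ℝ)..D, w τ = δ * (D / 2) := by
    rw [intervalIntegral.integral_of_le hD.le, setIntegral_indicator measurableSet_Ioc,
      inter_eq_self_of_subset_right sub2, ← intervalIntegral.integral_of_le mH.2,
      intervalIntegral.integral_const, smul_eq_mul]
    ring
  set Q : ℝ → ℝ := fun τ => P τ + (w τ - u τ) with hQ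
  have iQ : IntervalIntegrable Q volume 0 D := iP.add (wi.sub ui).intervalIntegrable
  have n0 : ∀ t ∈ Icc 0 D, 0 ≤ Q t := by
    intro t ht
    have h1 := hPf.nonneg t ht
    have h2 : u t ≤ P t := by
      by_cases hm : t ∈ Ioc 0 h
      · simp only [hu, indicator_of_mem hm]; linarith
      · simpa [hu, indicator_of_notMem hm] using h1
    have h3 := w0 t
    simp only [hQ]
    linarith
  -- Used with `β = b` for the temperature and `β = 0` for the energy.
  have hheat : ∀ β, 0 ≤ β → β ≤ b → ∀ t ∈ Icc 0 D,
      ∫ τ in (0 : ℝ)..t, Real.exp (β * τ) * (w τ - u τ) ≤ 0 := by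
    intro β hβ hβb t ht
    have iu : IntervalIntegrable (fun τ => Real.exp (β * τ) * u τ) volume 0 t :=
      ui.intervalIntegrable.continuousOn_mul (by fun_prop)
    have iw : IntervalIntegrable (fun τ => Real.exp (β * τ) * w τ) volume 0 t :=
      wi.intervalIntegrable.continuousOn_mul (by fun_prop)
    rcases le_total t (D / 2) with htD | htD
    · rw [intervalIntegral.integral_of_le ht.1]
      refine setIntegral_nonpos measurableSet_Ioc fun τ hτ => ?_
      have h1 : w τ = 0 := indicator_of_notMem (fun hn => by linarith [hn.1, hτ.2]) _
      rw [h1]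
      exact mul_nonpos_of_nonneg_of_nonpos (Real.exp_pos _).le (by linarith [u0 τ])
    · have h1 : ∫ τ in (0 : ℝ)..t, u τ ≤ ∫ τ in (0 : ℝ)..t, Real.exp (β * τ) * u τ :=
        intervalIntegral.integral_mono_on ht.1 ui.intervalIntegrable iu fun τ hτ =>
          le_mul_of_one_le_left (u0 τ) (Real.one_le_exp (mul_nonneg hβ hτ.1))
      have h2 : ∫ τ in (0 : ℝ)..t, Real.exp (β * τ) * w τ ≤
          ∫ τ in (0 : ℝ)..t, Real.exp (b * D) * w τ :=
        intervalIntegral.integral_mono_on ht.1 iw (wi.intervalIntegrable.const_mul _) fun τ hτ =>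
          mul_le_mul_of_nonneg_right (Real.exp_le_exp.2
            (mul_le_mul hβb (hτ.2.trans ht.2) hτ.1 hb)) (w0 τ)
      have h3 : ∫ τ in (0 : ℝ)..t, w τ ≤ ∫ τ in (0 : ℝ)..D, w τ :=
        intervalIntegral.integral_mono_interval le_rfl ht.1 ht.2
          (Filter.Eventually.of_forall w0) wi.intervalIntegrable
      rw [intervalIntegral.integral_const_mul] at h2
      have h4 := mul_le_mul_of_nonneg_left h3 (Real.exp_pos (b * D)).le
      rw [hwInt] at h4
      rw [huInt t (hhD.trans htD)] at h1
      simp only [mul_sub]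
      rw [intervalIntegral.integral_sub iw iu]
      linarith
  have hQf : IsFeasiblePolicy a b Te Tc T0 E D Q := by
    refine isFeasiblePolicy_of_total hD n0 iQ ?_ fun t ht => ?_
    · have h1 := hheat 0 le_rfl hb D mD
      simp only [zero_mul, Real.exp_zero, one_mul] at h1
      simp only [hQ]
      rw [intervalIntegral.integral_add (g := fun τ => w τ - u τ) iP
        (wi.sub ui).intervalIntegrable]
      linarith [hPf.energy_le D mD]
    · have iPt := hPf.intervalIntegrable hD m0 ht
      refine (temperature_le_of_integral_nonpos ha iPt
        (iPt.add (wi.sub ui).intervalIntegrable) ?_).trans (hPf.temperature_le t ht)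
      simp only [add_sub_cancel_left]
      exact hheat b hb le_rfl t ht
  have hopt := (throughput_le_iff _ _ _).1 (hP.throughput_le Q hQf)
  have lP := log_one_add_intervalIntegrable hPf.nonneg iP m0 mD
  have lQ := log_one_add_intervalIntegrable n0 iQ m0 mD
  set f1 : ℝ → ℝ := (Ioc 0 h).indicator fun _ => Real.log 2 with hf1
  set f2 : ℝ → ℝ := (Ioc (D / 2) D).indicator fun τ => δ / (1 + δ) * (1 + P τ)⁻¹ with hf2
  have f1i : Integrable f1 := (integrable_indicator_iff measurableSet_Ioc).2
    (integrableOn_const (hs := by simp))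
  have f2i : Integrable f2 := by
    refine (integrable_indicator_iff measurableSet_Ioc).2 ?_
    have := iI.const_mul (δ / (1 + δ))
    rwa [intervalIntegrable_iff, uIoc_of_le mH.2] at this
  have hf1Int : ∫ τ in (0 : ℝ)..D, f1 τ = h * Real.log 2 := by
    rw [intervalIntegral.integral_of_le hD.le, setIntegral_indicator measurableSet_Ioc,
      inter_eq_self_of_subset_right sub1, ← intervalIntegral.integral_of_le hh.le,
      intervalIntegral.integral_const, smul_eq_mul, sub_zero]
  have hf2Int : ∫ τ in (0 : ℝ)..D, f2 τ = δ / (1 + δ) * W := by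
    rw [intervalIntegral.integral_of_le hD.le, setIntegral_indicator measurableSet_Ioc,
      inter_eq_self_of_subset_right sub2, ← intervalIntegral.integral_of_le mH.2,
      intervalIntegral.integral_const_mul]
  have hmono := intervalIntegral.integral_mono_on hD.le
    (lP.add (f2i.sub f1i).intervalIntegrable) lQ (fun t ht => by
      have hp := hPf.nonneg t ht
      by_cases c1 : t ∈ Ioc 0 h
      · have c2 : t ∉ Ioc (D / 2) D := fun hn => by linarith [hn.1, c1.2]
        have := log_one_add_half_ge hp
        simp only [hf1, hf2, hQ, hu, hw, indicator_of_mem c1, indicator_of_notMem c2,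
          Pi.sub_apply, zero_sub, ← sub_eq_add_neg, sub_half]
        exact this
      · by_cases c2 : t ∈ Ioc (D / 2) D
        · have := log_one_add_add_ge hp hδ0
          simp only [hf1, hf2, hQ, hu, hw, indicator_of_mem c2, indicator_of_notMem c1,
            Pi.sub_apply, sub_zero]
          exact this
        · simp [hf1, hf2, hQ, hu, hw, indicator_of_notMem c1, indicator_of_notMem c2])
  rw [intervalIntegral.integral_add lP (f2i.sub f1i).intervalIntegrable] at hmono
  simp only [Pi.sub_apply] at hmono
  rw [intervalIntegral.integral_sub f2i.intervalIntegrable f1i.intervalIntegrable, hf1Int,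
    hf2Int] at hmono
  -- By optimality the gain cannot exceed the loss; as `δ` is bounded and proportional to `m`, this
  -- gives `m = O(h)`.
  have h5 : δ / (1 + δ) * W ≤ h * Real.log 2 := by linarith
  have h6 : δ * W ≤ h * Real.log 2 * (1 + δ) := by
    rw [div_mul_eq_mul_div, div_le_iff₀ (by positivity)] at h5
    exact h5
  have hδE : δ ≤ E * Real.exp (-(b * D)) / D := by
    rw [hδ]; gcongr
  have hlog : 0 ≤ h * Real.log 2 := mul_nonneg hh.le (Real.log_nonneg one_le_two)
  have h7 : δ * W ≤ h * Real.log 2 * (1 + E * Real.exp (-(b * D)) / D) :=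
    h6.trans (mul_le_mul_of_nonneg_left (by linarith) hlog)
  rw [div_mul_eq_mul_div, le_div_iff₀ hWpos, ← hδm]
  have h8 := mul_le_mul_of_nonneg_left h7
    (mul_nonneg hD.le (Real.exp_pos (b * D)).le)
  linarith

/-! ### The monotone representative. -/

/-- Before the critical temperature is reached, an optimal policy agrees almost everywhere with a
non-increasing function. -/
theorem IsOptimalPolicy.exists_antitone {a b Te Tc T0 E D : ℝ} (ha : 0 < a) (hb : 0 ≤ b)
    (hD : 0 < D) {P : ℝ → ℝ} (hP : IsOptimalPolicy a b Te Tc T0 E D P) {r : ℝ} (hr : r ≤ D)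
    (hT : ∀ t, 0 ≤ t → t < r → temperature a b Te T0 P t < Tc) :
    ∃ Q : ℝ → ℝ, Antitone Q ∧ ∀ᵐ τ, τ ∈ Ioo 0 r → Q τ = P τ := by
  have mD : D ∈ Icc 0 D := ⟨hD.le, le_rfl⟩
  have m0 : (0 : ℝ) ∈ Icc 0 D := ⟨le_rfl, hD.le⟩
  have hPf := hP.feasible
  have iP := hPf.intervalIntegrable hD m0 mD
  set F : ℝ → ℝ := fun t => ∫ τ in (0 : ℝ)..t, P τ with hF
  -- `A` has full measure in `(0, r)`, and on it `P` is a limit of difference quotients of `F`,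
  -- which `hshift` orders.
  set A : Set ℝ := {t | t ∈ Ioo 0 r ∧ HasDerivAt F (P t) t} with hA
  have hFsub : ∀ s ∈ Icc 0 D, ∀ t ∈ Icc 0 D, F t - F s = ∫ τ in s..t, P τ := fun s hs t ht =>
    intervalIntegral.integral_interval_sub_left (hPf.intervalIntegrable hD m0 ht)
      (hPf.intervalIntegrable hD m0 hs)
  have hshift : ∀ x d h, 0 ≤ x → 0 < h → h ≤ d → x + d + h < r →
      F (x + d + h) - F (x + d) ≤ F (x + h) - F x := by
    intro x d h hx hh hhd hxr
    have mx : x ∈ Icc 0 D := ⟨hx, by linarith⟩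
    have mxh : x + h ∈ Icc 0 D := ⟨by linarith, by linarith⟩
    have mxd : x + d ∈ Icc 0 D := ⟨by linarith, by linarith⟩
    have mxhd : x + d + h ∈ Icc 0 D := ⟨by linarith, by linarith⟩
    have h1 := hP.ae_shift_le ha hb hD hx hh hhd (by linarith)
      fun t ht => hT t ht.1 (by linarith [ht.2])
    have h2 : ∫ τ in x..(x + h), P (τ + d) = ∫ τ in (x + d)..(x + d + h), P τ := by
      rw [intervalIntegral.integral_comp_add_right, show x + h + d = x + d + h by ring]
    rw [hFsub _ mxd _ mxhd, hFsub _ mx _ mxh, ← h2,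
      intervalIntegral.integral_of_le (by linarith), intervalIntegral.integral_of_le (by linarith)]
    have i2 : IntervalIntegrable (fun τ => P (τ + d)) volume x (x + h) := by
      have := (hPf.intervalIntegrable hD mxd mxhd).comp_add_right d
      rwa [add_sub_cancel_right, show x + d + h - d = x + h by ring] at this
    have i1 := hPf.intervalIntegrable hD mx mxh
    rw [intervalIntegrable_iff, uIoc_of_le (by linarith)] at i1 i2
    exact setIntegral_mono_on_ae i2 i1 measurableSet_Ioc h1
  have hanti : AntitoneOn P A := by
    rintro s ⟨hs, hs'⟩ t ⟨ht, ht'⟩ hst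
    rcases hst.eq_or_lt with rfl | hlt
    · exact le_rfl
    refine le_of_tendsto_of_tendsto ht'.tendsto_slope_zero_right hs'.tendsto_slope_zero_right ?_
    filter_upwards [Ioo_mem_nhdsGT (show 0 < min (t - s) (r - t) from
      lt_min (by linarith) (by linarith [ht.2]))] with h hh
    have h1 := hshift s (t - s) h hs.1.le hh.1 (hh.2.le.trans (min_le_left _ _))
      (by linarith [hh.2.trans_le (min_le_right _ _)])
    rw [add_sub_cancel] at h1
    exact smul_le_smul_of_nonneg_left h1 (inv_nonneg.2 hh.1.le)
  obtain ⟨C, hC⟩ := hP.exists_integral_le ha hb hD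
  -- A nonincreasing function could blow up at 0; this bound permits a real-valued antitone
  -- extension.
  have hbdd : ∀ t ∈ A, P t ≤ C := by
    rintro t ⟨ht, ht'⟩
    refine le_of_tendsto ht'.tendsto_slope_zero_right ?_
    filter_upwards [Ioo_mem_nhdsGT (show 0 < min (min t (D / 2)) (r - t) from
      lt_min (lt_min ht.1 (by linarith)) (by linarith [ht.2]))] with h hh
    have h0 := hh.2.le.trans (min_le_left _ _)
    have h1 := hshift 0 t h le_rfl hh.1 (h0.trans (min_le_left _ _))
      (by linarith [hh.2.trans_le (min_le_right _ _)])
    have h2 := hC h hh.1 (h0.trans (min_le_right _ _))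
    have h3 : F 0 = 0 := by simp [hF]
    rw [zero_add, zero_add, h3, sub_zero] at h1
    rw [smul_eq_mul, inv_mul_le_iff₀ hh.1, mul_comm]
    exact h1.trans h2
  obtain ⟨Q, hQ, hQP⟩ := hanti.exists_antitone_extension
    ⟨0, by
      rintro _ ⟨t, ht, rfl⟩
      exact hPf.nonneg t ⟨ht.1.1.le, ht.1.2.le.trans hr⟩⟩
    ⟨C, by
      rintro _ ⟨t, ht, rfl⟩
      exact hbdd t ht⟩
  refine ⟨Q, hQ, ?_⟩
  filter_upwards [iP.ae_hasDerivAt_integral] with t ht hm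
  refine (hQP ⟨hm, ht ?_ 0 (by simp)⟩).symm
  rw [uIcc_of_le hD.le]
  exact ⟨hm.1.le, hm.2.le.trans hr⟩

/-! ### Shape of the temperature and conclusion. -/

theorem IsOptimalPolicy.congr {a b Te Tc T0 E D : ℝ} (hD : 0 < D) {P Q : ℝ → ℝ}
    (hP : IsOptimalPolicy a b Te Tc T0 E D P) (h0 : ∀ t ∈ Icc 0 D, 0 ≤ Q t)
    (hQP : ∀ᵐ τ, τ ∈ Ioo 0 D → Q τ = P τ) : IsOptimalPolicy a b Te Tc T0 E D Q := by
  have mD : D ∈ Icc 0 D := ⟨hD.le, le_rfl⟩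
  have m0 : (0 : ℝ) ∈ Icc 0 D := ⟨le_rfl, hD.le⟩
  have hD' : ∀ᵐ x : ℝ, x ≠ D := by simp [ae_iff]
  have hQP' : ∀ᵐ τ, τ ∈ Ioc 0 D → Q τ = P τ := by
    filter_upwards [hQP, hD'] with x hx hxD hm
    exact hx ⟨hm.1, lt_of_le_of_ne hm.2 hxD⟩
  have hI : ∀ f : ℝ → ℝ, ∫ τ in (0 : ℝ)..D, f (Q τ) = ∫ τ in (0 : ℝ)..D, f (P τ) := fun f =>
    intervalIntegral.integral_congr_ae (by
      rw [uIoc_of_le hD.le]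
      filter_upwards [hQP'] with x hx hm
      rw [hx hm])
  have hthr : throughput D Q = throughput D P := hI fun p => 1 / 2 * Real.logb 2 (1 + p)
  refine ⟨isFeasiblePolicy_of_total hD h0 ?_ ?_ fun t ht => ?_, fun R hR => ?_⟩
  · refine (hP.feasible.intervalIntegrable hD m0 mD).congr_ae ?_
    rw [uIoc_of_le hD.le, Filter.EventuallyEq, ae_restrict_iff' measurableSet_Ioc]
    filter_upwards [hQP'] with x hx hm
    exact (hx hm).symm
  · exact (hI id).trans_le (hP.feasible.energy_le D mD)
  · rw [temperature_congr a b Te T0 ht.1 (by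
      filter_upwards [hQP'] with x hx hm
      exact hx ⟨hm.1, hm.2.trans ht.2⟩)]
    exact hP.feasible.temperature_le t ht
  · rw [hthr]
    exact hP.throughput_le R hR

/-- `exp (b t) * (T - Tc)` is nonpositive and nondecreasing; dividing by the growing exponential
keeps `T - Tc` nondecreasing. -/
theorem temperature_monotoneOn {a b Te Tc T0 E D : ℝ} (ha : 0 < a) (hb : 0 ≤ b) (hD : 0 < D)
    {P : ℝ → ℝ} (hP : IsFeasiblePolicy a b Te Tc T0 E D P)
    (hle : ∀ᵐ τ, τ ∈ Ioo 0 D → (Tc - Te) * b / a ≤ P τ) :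
    MonotoneOn (temperature a b Te T0 P) (Icc 0 D) := by
  intro s hs t ht hst
  have hD' : ∀ᵐ x : ℝ, x ≠ D := by simp [ae_iff]
  have h1 := le_temperature_of_ge (T0 := T0) ha
    (hP.intervalIntegrable hD ⟨le_rfl, hD.le⟩ ⟨hD.le, le_rfl⟩) hs ht hst (by
      filter_upwards [hle, hD'] with x hx hxD hm
      exact hx ⟨hs.1.trans_lt hm.1, lt_of_le_of_ne (hm.2.trans ht.2) hxD⟩)
  have h2 : Real.exp (b * t) * (temperature a b Te T0 P t - Tc) ≤
      Real.exp (b * s) * (temperature a b Te T0 P t - Tc) :=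
    mul_le_mul_of_nonpos_right (Real.exp_le_exp.2 (mul_le_mul_of_nonneg_left hst hb))
      (sub_nonpos.2 (hP.temperature_le t ht))
  have h3 := le_of_mul_le_mul_left (h1.trans h2) (Real.exp_pos _)
  linarith

/-- The slope `a Q - b (T - Te)` is nonincreasing, so its value at the middle point separates the
two adjacent chord slopes. -/
theorem temperature_concaveOn {a b Te T0 D : ℝ} (ha : 0 < a) (hb : 0 ≤ b) (hD : 0 < D)
    {P Q : ℝ → ℝ} (hP : IntervalIntegrable P volume 0 D) (hQ : AntitoneOn Q (Icc 0 D))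
    (hQP : ∀ᵐ τ, τ ∈ Ioo 0 D → Q τ = P τ)
    (hmono : MonotoneOn (temperature a b Te T0 P) (Icc 0 D)) :
    ConcaveOn ℝ (Icc 0 D) (temperature a b Te T0 P) := by
  refine concaveOn_of_slope_anti_adjacent (convex_Icc 0 D) fun {x y z} hx hz hxy hyz => ?_
  have hy : y ∈ Icc 0 D := ⟨hx.1.trans hxy.le, hyz.le.trans hz.2⟩
  set T := temperature a b Te T0 P
  have hi : IntervalIntegrable (fun τ => a * P τ - b * (T τ - Te)) volume 0 D := by
    refine (hP.const_mul a).sub (ContinuousOn.intervalIntegrable ?_)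
    rw [uIcc_of_le hD.le]
    exact continuousOn_const.mul
      ((temperature_continuousOn a b Te T0 D hD.le hP).sub continuousOn_const)
  have hi' : ∀ s ∈ Icc 0 D, ∀ t ∈ Icc 0 D,
      IntervalIntegrable (fun τ => a * P τ - b * (T τ - Te)) volume s t := fun s hs t ht =>
    hi.mono_set (by rw [uIcc_of_le hD.le]; exact uIcc_subset_Icc hs ht)
  have h0 : ∀ᵐ x : ℝ, x ≠ 0 := by simp [ae_iff]
  have hD' : ∀ᵐ x : ℝ, x ≠ D := by simp [ae_iff]
  have e1 := temperature_sub_eq_integral a b Te T0 D hD hP hy hz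
  have e2 := temperature_sub_eq_integral a b Te T0 D hD hP hx hy
  have h1 : T z - T y ≤ (z - y) * (a * Q y - b * (T y - Te)) := by
    refine (e1.trans_le (intervalIntegral.integral_mono_ae_restrict hyz.le (hi' y hy z hz)
      (intervalIntegrable_const (c := a * Q y - b * (T y - Te))) ?_)).trans_eq (by simp; ring)
    rw [Filter.EventuallyLE, ae_restrict_iff' measurableSet_Icc]
    filter_upwards [hQP, h0, hD'] with t ht ht0 htD hm
    have mt : t ∈ Icc 0 D := ⟨hy.1.trans hm.1, hm.2.trans hz.2⟩
    have hPt := ht ⟨lt_of_le_of_ne mt.1 ht0.symm, lt_of_le_of_ne mt.2 htD⟩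
    have h3 := mul_le_mul_of_nonneg_left (hQ hy mt hm.1) ha.le
    have h4 := mul_le_mul_of_nonneg_left (hmono hy mt hm.1) hb
    rw [← hPt]
    linarith
  have h2 : (y - x) * (a * Q y - b * (T y - Te)) ≤ T y - T x := by
    refine Eq.trans_le (by simp; ring) ((intervalIntegral.integral_mono_ae_restrict hxy.le
      (intervalIntegrable_const (c := a * Q y - b * (T y - Te))) (hi' x hx y hy) ?_).trans_eq
        e2.symm)
    rw [Filter.EventuallyLE, ae_restrict_iff' measurableSet_Icc]
    filter_upwards [hQP, h0, hD'] with t ht ht0 htD hm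
    have mt : t ∈ Icc 0 D := ⟨hx.1.trans hm.1, hm.2.trans hy.2⟩
    have hPt := ht ⟨lt_of_le_of_ne mt.1 ht0.symm, lt_of_le_of_ne mt.2 htD⟩
    have h3 := mul_le_mul_of_nonneg_left (hQ mt hy hm.2) ha.le
    have h4 := mul_le_mul_of_nonneg_left (hmono mt hy hm.2) hb
    rw [← hPt]
    linarith
  calc (T z - T y) / (z - y) ≤ a * Q y - b * (T y - Te) := by
        rw [div_le_iff₀ (by linarith)]; linarith
    _ ≤ (T y - T x) / (y - x) := by
        rw [le_div_iff₀ (by linarith)]; linarith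

theorem ae_restrict_eq_of_ae_Ioo {D : ℝ} {P Q : ℝ → ℝ}
    (hQP : ∀ᵐ τ, τ ∈ Ioo 0 D → Q τ = P τ) : Q =ᵐ[volume.restrict (Icc 0 D)] P := by
  rw [Measure.restrict_congr_set Ioo_ae_eq_Icc.symm, Filter.EventuallyEq,
    ae_restrict_iff' measurableSet_Ioo]
  exact hQP

theorem lemma17 (a b Te Tc T0 E D : ℝ) (ha : 0 < a) (hb : 0 ≤ b) (hTc : Te < Tc) (hE : 0 ≤ E)
    (hD : 0 < D) :
    (Te < T0 → T0 < Tc → ∀ P : ℝ → ℝ, IsOptimalPolicy a b Te Tc T0 E D P →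
      ∃ Q : ℝ → ℝ, IsOptimalPolicy a b Te Tc T0 E D Q ∧
        Q =ᵐ[volume.restrict (Icc 0 D)] P ∧
        AntitoneOn Q (Icc 0 D) ∧
        ∀ t_h : ℝ, IsLeast {t | t ∈ Icc 0 D ∧ temperature a b Te T0 P t = Tc} t_h → t_h < D →
          (∀ t ∈ Icc t_h D, Q t = (Tc - Te) * b / a) ∧
          MonotoneOn (temperature a b Te T0 P) (Icc 0 D) ∧
          ConcaveOn ℝ (Icc 0 D) (temperature a b Te T0 P)) ∧
    (T0 = Tc →
      IsOptimalPolicy a b Te Tc T0 E D (fun _ => min ((Tc - Te) * b / a) (E / D)) ∧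
      ∀ P : ℝ → ℝ, IsOptimalPolicy a b Te Tc T0 E D P →
        ∀ᵐ t ∂(volume.restrict (Icc 0 D)), P t = min ((Tc - Te) * b / a) (E / D)) := by
  have mD : D ∈ Icc 0 D := ⟨hD.le, le_rfl⟩
  have m0 : (0 : ℝ) ∈ Icc 0 D := ⟨le_rfl, hD.le⟩
  constructor
  · intro _ hT0 P hP
    have hPf := hP.feasible
    have iP := hPf.intervalIntegrable hD m0 mD
    have hc0 : 0 ≤ (Tc - Te) * b / a := div_nonneg (mul_nonneg (by linarith) hb) ha.le
    set K : Set ℝ := {t | t ∈ Icc 0 D ∧ temperature a b Te T0 P t = Tc} with hK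
    by_cases hex : ∃ r, IsLeast K r ∧ r < D
    · obtain ⟨r, hr, hrD⟩ := hex
      have hrI : r ∈ Icc 0 D := hr.1.1
      have hbefore : ∀ t, 0 ≤ t → t < r → temperature a b Te T0 P t < Tc := by
        intro t ht0 htr
        have mt : t ∈ Icc 0 D := ⟨ht0, htr.le.trans hrI.2⟩
        refine lt_of_le_of_ne (hPf.temperature_le t mt) fun h => ?_
        exact absurd (hr.2 ⟨mt, h⟩) (not_le.2 htr)
      have hafter := hP.ae_eq_after_critical ha hb hD hT0 hr hrD
      obtain ⟨Q₀, hQ₀, hQ₀P⟩ := hP.exists_antitone ha hb hD hrI.2 hbefore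
      set c := (Tc - Te) * b / a with hc
      have hr' : ∀ᵐ x : ℝ, x ≠ r := by simp [ae_iff]
      -- Once below `c`, a nonincreasing power stays below and cannot raise the temperature to `Tc`
      -- at `r`.
      have hQ₀c : ∀ t ∈ Ioo 0 r, c ≤ Q₀ t := by
        intro t ht
        by_contra hlt
        have mt : t ∈ Icc 0 D := ⟨ht.1.le, ht.2.le.trans hrI.2⟩
        have h1 := temperature_le_of_le (Tc := Tc) (Te := Te) (b := b) (T0 := T0) ha iP mt hrI
          ht.2.le (by
            filter_upwards [hQ₀P, hr'] with x hx hxr hm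
            rw [← hx ⟨ht.1.trans hm.1, lt_of_le_of_ne hm.2 hxr⟩]
            exact (hQ₀ hm.1.le).trans (not_le.1 hlt).le)
        rw [hr.1.2, sub_self, mul_zero] at h1
        linarith [nonneg_of_mul_nonneg_right h1 (Real.exp_pos _), hbefore t ht.1.le ht.2]
      -- The maximum only matters off `(0, r)`, where `Q₀` is uncontrolled, notably at 0; it gives
      -- `c ≤ Q` everywhere.
      set Q : ℝ → ℝ := fun t => if t < r then max (Q₀ t) c else c with hQ
      have hQc : ∀ t, c ≤ Q t := by
        intro t
        simp only [hQ]
        split_ifs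
        exacts [le_max_right _ _, le_rfl]
      have hQanti : Antitone Q := by
        intro s t hst
        by_cases htr : t < r
        · simp only [hQ, htr, hst.trans_lt htr, if_true]
          exact max_le_max_right _ (hQ₀ hst)
        · have : Q t = c := by simp [hQ, htr]
          rw [this]
          exact hQc s
      have hQP : ∀ᵐ τ, τ ∈ Ioo 0 D → Q τ = P τ := by
        filter_upwards [hQ₀P, hafter, hr'] with x h1 h2 h3 hm
        rcases lt_or_gt_of_ne h3 with h | h
        · simp only [hQ, h, if_true]
          rw [max_eq_left (hQ₀c x ⟨hm.1, h⟩)]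
          exact h1 ⟨hm.1, h⟩
        · simp only [hQ, not_lt.2 h.le, if_false]
          exact (h2 ⟨h, hm.2.le⟩).symm
      refine ⟨Q, hP.congr hD (fun t _ => hc0.trans (hQc t)) hQP, ae_restrict_eq_of_ae_Ioo hQP,
        hQanti.antitoneOn _, fun t_h hth hthD => ?_⟩
      have hmono := temperature_monotoneOn ha hb hD hPf (by
        filter_upwards [hQP] with x hx hm
        rw [← hx hm]
        exact hQc x)
      refine ⟨fun t ht => ?_, hmono,
        temperature_concaveOn ha hb hD iP (hQanti.antitoneOn _) hQP hmono⟩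
      rw [hth.unique hr] at ht
      simp [hQ, not_lt.2 ht.1]
    -- Here `Tc` is reached at `D` at the earliest, if at all, so the monotone representative covers
    -- the whole interval.
    · have hbefore : ∀ t, 0 ≤ t → t < D → temperature a b Te T0 P t < Tc := by
        intro t ht0 htD
        have mt : t ∈ Icc 0 D := ⟨ht0, htD.le⟩
        refine lt_of_le_of_ne (hPf.temperature_le t mt) fun h => hex ?_
        have hKc : IsCompact K := isCompact_Icc.of_isClosed_subset
          ((temperature_continuousOn a b Te T0 D hD.le iP).preimage_isClosed_of_isClosed
            isClosed_Icc (isClosed_singleton (x := Tc))) fun x hx => hx.1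
        obtain ⟨r, hr⟩ := hKc.exists_isLeast ⟨t, mt, h⟩
        exact ⟨r, hr, (hr.2 ⟨mt, h⟩).trans_lt htD⟩
      obtain ⟨Q₀, hQ₀, hQ₀P⟩ := hP.exists_antitone ha hb hD le_rfl hbefore
      have hQP : ∀ᵐ τ, τ ∈ Ioo 0 D → max (Q₀ τ) 0 = P τ := by
        filter_upwards [hQ₀P] with x hx hm
        rw [hx hm, max_eq_left (hPf.nonneg x ⟨hm.1.le, hm.2.le⟩)]
      exact ⟨fun t => max (Q₀ t) 0, hP.congr hD (fun t _ => le_max_right _ _) hQP,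
        ae_restrict_eq_of_ae_Ioo hQP, fun s _ t _ hst => max_le_max_right _ (hQ₀ hst),
        fun t_h hth hthD => absurd ⟨t_h, hth, hthD⟩ hex⟩
  · rintro rfl
    have hopt := isOptimalPolicy_const ha hb hTc hE hD
    refine ⟨hopt, fun P hP => ?_⟩
    rw [ae_restrict_iff' measurableSet_Icc]
    filter_upwards [hP.ae_eq hD hopt.feasible
      ((throughput_le_iff _ _ _).1 (hopt.throughput_le P hP.feasible))] with t ht hm
    exact (ht hm).symm
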